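/- Let $d\ge 2$, and let $X=\nu_d(\mathbb P^1)\subset\mathbb P^d$ be the rational normal curve over $\mathbb C$, i.e. the set of points $[L^d]$ ($L\neq 0$ a linear form in $x,y$) in the projective space $\mathbb P^d$ of binary forms of degree $d$. Let $f\in\mathbb C[x,y]$ be a nonzero binary form of degree $d$, and let $\mathrm{rk}_{\mathbb C}(f)$ be its complex rank, the least number of distinct points of $X$ whose linear span contains $[f]$. For a zero-dimensional subscheme $Z$ of $\mathbb P^d$, let $\langle Z\rangle$ be its linear span, the common zero set of all linear forms on $\mathbb P^d$ that vanish on the scheme $Z$. Define the following subsets of $X$: - the forbidden locus $\mathfrak F(f)$, the set of $\ell\in X$ that are not in the support of any smooth zero-dimensional subscheme $Z\subset X$ of length $\mathrm{rk}_{\mathbb C}(f)$ with $[f]\in\langle Z\rangle$; - the Ranestad–Schreyer locus of length two $\mathfrak{RS}(f)_2$, the set of $\ell\in X$ for which there is a zero-dimensional subscheme $Z\subset X$ of length $2$ with $[f]\in\langle Z\rangle$ that has $\ell$ as a non-reduced point. Then: 1. If $f$ has maximal complex rank $\mathrm{rk}_{\mathbb C}(f)=d$, then $\mathfrak F(f)=\mathfrak{RS}(f)_2$.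 2. If $\mathrm{rk}_{\mathbb C}(f)\neq d$, then $\mathfrak F(f)\neq\emptyset$; if moreover $f$ is not the $d$-th power of a linear form (i.e. $[f]\notin X$), then $\mathfrak{RS}(f)_2=\emptyset$. -/

import Mathlib

open scoped LinearAlgebra.Projectivization

noncomputable section

/-! ### Projective space, vanishing, and closed subschemes -/

/-- The set of closed points of the complex projective space `ℙ^N`. -/
abbrev PSpace (N : ℕ) : Type := ℙ ℂ (Fin (N + 1) → ℂ)

/-- The homogeneous coordinate ring of `ℙ^N`. -/
abbrev CoordRing (N : ℕ) : Type := MvPolynomial (Fin (N + 1)) ℂ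

/-- The polynomial `g` vanishes at the point `p`. This is used for homogeneous `g` only, where it
does not depend on the representative of `p`. -/
def VanishesAt {N : ℕ} (g : CoordRing N) (p : PSpace N) : Prop :=
  MvPolynomial.eval p.rep g = 0

/-- A closed subscheme of `ℙ^N`, given by its saturated homogeneous ideal. -/
structure ProjSubscheme (N : ℕ) where
  ideal : Ideal (CoordRing N)
  homogeneous : ∀ g ∈ ideal, ∀ n, MvPolynomial.homogeneousComponent n g ∈ ideal
  saturated : ∀ g : CoordRing N, (∀ i, MvPolynomial.X i * g ∈ ideal) → g ∈ ideal

namespace ProjSubscheme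

variable {N : ℕ} (Z : ProjSubscheme N)

/-- The support of `Z`: its closed points. -/
def support : Set (PSpace N) :=
  {p | ∀ g ∈ Z.ideal, ∀ n, g.IsHomogeneous n → VanishesAt g p}

/-- `Z` is a subscheme of the (reduced) projective variety with set of points `X`: the ideal of `Z`
contains every form that vanishes on `X`. -/
def ContainedIn (X : Set (PSpace N)) : Prop :=
  ∀ (g : CoordRing N) (n : ℕ), g.IsHomogeneous n → (∀ p ∈ X, VanishesAt g p) → g ∈ Z.ideal

/-- The Hilbert function of `Z`: the dimension of the degree `n` part of `S / I_Z`. -/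
def hilbertFunction (n : ℕ) : ℕ :=
  Module.finrank ℂ
    ((MvPolynomial.homogeneousSubmodule (Fin (N + 1)) ℂ n).map
      (Ideal.Quotient.mkₐ ℂ Z.ideal).toLinearMap)

/-- `Z` is zero-dimensional of length `s`: its Hilbert polynomial is the constant `s`. -/
def HasLength (s : ℕ) : Prop :=
  ∀ᶠ n in Filter.atTop, Z.hilbertFunction n = s

/-- The linear span `⟨Z⟩`: the common zeros of all linear forms in the ideal of `Z`. -/
def linearSpan : Set (PSpace N) :=
  {p | ∀ g ∈ Z.ideal, g.IsHomogeneous 1 → VanishesAt g p}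

/-- `Z` is reduced, that is, its saturated ideal is radical. For a zero-dimensional scheme over `ℂ`
this is the same as being smooth. -/
def IsReducedScheme : Prop := Z.ideal.IsRadical

/-- The germ at `p` of the form `g` (divided by any form of the same degree that does not vanish at
`p`) is zero in the local ring of `Z` at `p`. -/
def GermZero (g : CoordRing N) (p : PSpace N) : Prop :=
  ∃ (m : ℕ) (u : CoordRing N), u.IsHomogeneous m ∧ ¬ VanishesAt u p ∧ u * g ∈ Z.ideal

/-- `p` is a non-reduced point of `Z`: it lies on `Z` and the local ring of `Z` at `p` contains a
nonzero nilpotent element. -/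
def IsNonreducedAt (p : PSpace N) : Prop :=
  p ∈ Z.support ∧
    ∃ (n : ℕ) (g : CoordRing N), g.IsHomogeneous n ∧ (∃ k, Z.GermZero (g ^ k) p) ∧ ¬ Z.GermZero g p

end ProjSubscheme

/-! ### Rank, forbidden locus, Ranestad–Schreyer loci -/

/-- The `X`-rank of `f`: the least number of distinct points of `X` whose span contains `f`. -/
def xRank {N : ℕ} (X : Set (PSpace N)) (f : PSpace N) : ℕ :=
  sInf {s | ∃ A : Finset (PSpace N), (A : Set (PSpace N)) ⊆ X ∧ A.card = s ∧
    f.submodule ≤ ⨆ q ∈ A, q.submodule}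

/-- The forbidden locus: the points of `X` that are not in the support of any smooth
zero-dimensional subscheme `Z ⊆ X` of length the `X`-rank of `f` with `f ∈ ⟨Z⟩`. -/
def forbiddenLocus {N : ℕ} (X : Set (PSpace N)) (f : PSpace N) : Set (PSpace N) :=
  {l | l ∈ X ∧ ¬ ∃ Z : ProjSubscheme N, Z.ContainedIn X ∧ Z.HasLength (xRank X f) ∧
    Z.IsReducedScheme ∧ f ∈ Z.linearSpan ∧ l ∈ Z.support}

/-- The Ranestad–Schreyer locus of length `s`: the points of `X` that are a non-reduced point of
some zero-dimensional subscheme `Z ⊆ X` of length `s` with `f ∈ ⟨Z⟩`. -/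
def ranestadSchreyerLocus {N : ℕ} (X : Set (PSpace N)) (f : PSpace N) (s : ℕ) :
    Set (PSpace N) :=
  {l | l ∈ X ∧ ∃ Z : ProjSubscheme N, Z.ContainedIn X ∧ Z.HasLength s ∧
    f ∈ Z.linearSpan ∧ Z.IsNonreducedAt l}

/-! ### Binary forms and the rational normal curve -/

/-- The coefficients of `x^d, x^(d-1) y, …, y^d` in a binary form of degree `d`. -/
def coeffVec (d : ℕ) (f : MvPolynomial (Fin 2) ℂ) : Fin (d + 1) → ℂ :=
  fun i => f.coeff (Finsupp.single 0 (d - (i : ℕ)) + Finsupp.single 1 (i : ℕ))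

theorem coeffVec_ne_zero {d : ℕ} {f : MvPolynomial (Fin 2) ℂ} (hf : f.IsHomogeneous d)
    (hf0 : f ≠ 0) : coeffVec d f ≠ 0 := by
  intro h
  apply hf0
  ext m
  rw [MvPolynomial.coeff_zero]
  by_contra hm
  have hdeg : m 0 + m 1 = d := by
    have h1 := hf hm
    rw [Finsupp.weight_apply, Finsupp.sum_fintype _ _ (by simp)] at h1
    simpa [Fin.sum_univ_two] using h1
  have h2 := congrFun h ⟨m 1, by omega⟩
  apply hm
  have h3 : m = Finsupp.single 0 (d - m 1) + Finsupp.single 1 (m 1) := by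
    ext i
    fin_cases i
    · simp; omega
    · simp
  rw [h3]
  exact h2

/-- The point of `ℙ^d`, the projective space of binary forms of degree `d`, defined by a nonzero
form `f`. -/
def formPoint (d : ℕ) (f : MvPolynomial (Fin 2) ℂ) (hf : f.IsHomogeneous d) (hf0 : f ≠ 0) :
    PSpace d :=
  Projectivization.mk ℂ (coeffVec d f) (coeffVec_ne_zero hf hf0)

/-- The rational normal curve `ν_d(ℙ^1) ⊆ ℙ^d`: the points `[L^d]` for nonzero linear forms `L`. -/
def rationalNormalCurve (d : ℕ) : Set (PSpace d) :=
  {p | ∃ (L : MvPolynomial (Fin 2) ℂ) (hL : L.IsHomogeneous 1) (hL0 : L ≠ 0),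
    p = formPoint d (L ^ d) (by simpa using hL.pow d) (pow_ne_zero d hL0)}

end

noncomputable section
open Polynomial

/-! ### Apolarity for binary forms

A binary form of degree `k` is given by a univariate polynomial of degree at most `k`; the drop of
the degree is the multiplicity of the root at infinity, which is `none : Option ℂ`. -/

/-! Everything is translated into Sylvester's apolarity. A binary form `f` of degree `d` acts as a
functional `φ` on univariate polynomials of degree at most `d`. A finite set `A` of points of the
curve spans `[f]` exactly when the form with root set `A` is apolar (`isApolar_rootForm_iff`), and
`[f]` lies on the tangent line at `p` exactly when the square of the linear form with root `p` is
apolar (`isApolar_squareForm_iff`). On the geometric side, smooth subschemes can be replaced by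
their finite supports (`mem_forbiddenLocus_iff`), and a length two subscheme that is non-reduced at
`l` spans the tangent line at `l` (`mem_ranestadSchreyerLocus_iff`). So the rank is the least degree
of an apolar form with distinct roots, the forbidden points are those that are never roots of such a
form of least degree, and the Ranestad–Schreyer locus is the set of apolar squares.

The engine is `IsApolar.gcd_apolar`: the gcd, of degree `e`, of apolar forms of degrees `a` and `b`
is apolar once `a + b ≤ d + 1 + e`. Let `g` be a nonzero apolar form of least degree `r`. An apolar
form of degree at most `d + 2 - r` that shares a root with `g` is then a multiple of `g`, and some
apolar form of degree exactly `d + 2 - r` has distinct roots. A multiple root of `g` is therefore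
forbidden. If `g` has none, `r` is the rank, and either the decomposition is unique or the apolar
forms of degree `r` contain a pencil, one of whose members has a multiple root. So the forbidden
locus is never empty.

If the rank is `d`, some square is apolar, that is, `f = L ^ (d - 1) M` up to scalar. Averaging over
roots of unity writes `f` with at most `d` powers, one of them prescribed outside the tangency
points (`exists_finset_of_tangent`), so every forbidden point is a tangency point. Conversely, an
apolar square at `p` and an apolar form of degree at most `d` with distinct roots, one of them `p`,
have gcd the linear form at `p`, so `f` is a `d`-th power. This gives the other inclusion, and also
the emptiness when the rank is smaller than `d`; a rank above `d` is excluded by the explicit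
decompositions. -/

/-- The form `g` of degree `k` is apolar to the functional `φ` on forms of degree `d`. -/
def IsApolar (φ : ℂ[X] →ₗ[ℂ] ℂ) (d k : ℕ) (g : ℂ[X]) : Prop :=
  ∀ u : ℂ[X], u.natDegree + k ≤ d → φ (g * u) = 0

/-- `p` is a root of the form `g` of degree `k`. -/
def IsFormRoot (k : ℕ) (g : ℂ[X]) : Option ℂ → Prop
  | none => g.natDegree < k
  | some t => g.IsRoot t

/-- `p` is a multiple root of the form `g` of degree `k`. -/
def IsFormDoubleRoot (k : ℕ) (g : ℂ[X]) : Option ℂ → Prop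
  | none => g.natDegree + 2 ≤ k
  | some t => (X - C t) ^ 2 ∣ g

/-- The monic form whose roots are the points of `A`. -/
def rootForm (A : Finset (Option ℂ)) : ℂ[X] := ∏ t ∈ A.eraseNone, (X - C t)

theorem IsFormDoubleRoot.isFormRoot {k : ℕ} {g : ℂ[X]} {p : Option ℂ}
    (h : IsFormDoubleRoot k g p) : IsFormRoot k g p := by
  cases p with
  | none => simp only [IsFormDoubleRoot, IsFormRoot] at *; omega
  | some t => exact dvd_iff_isRoot.mp ((dvd_pow_self _ two_ne_zero).trans h)

section Apolar

variable {φ : ℂ[X] →ₗ[ℂ] ℂ} {d : ℕ}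

theorem IsApolar.add {k : ℕ} {g h : ℂ[X]} (hg : IsApolar φ d k g) (hh : IsApolar φ d k h) :
    IsApolar φ d k (g + h) := fun u hu => by
  rw [add_mul, map_add, hg u hu, hh u hu, add_zero]

theorem IsApolar.smul {k : ℕ} {g : ℂ[X]} (c : ℂ) (hg : IsApolar φ d k g) :
    IsApolar φ d k (c • g) := fun u hu => by
  rw [smul_mul_assoc, map_smul, hg u hu, smul_zero]

theorem IsApolar.mul {k m : ℕ} {g v : ℂ[X]} (hg : IsApolar φ d k g) (hv : v.natDegree + k ≤ m) :
    IsApolar φ d m (g * v) := fun u hu => by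
  rw [mul_assoc]
  refine hg _ ?_
  have := natDegree_mul_le (p := v) (q := u)
  omega

/-- Coprime forms of degrees `a - e` and `b - e` generate all forms of degree `d - e` as soon as `d
- e ≥ (a - e) + (b - e) - 1`, and `φ` kills `q` times either generator. By `hga`, `g` does not
vanish at infinity, so degrees can be controlled by division by `g`. -/
theorem IsApolar.of_isCoprime {a b e : ℕ} {q g h : ℂ[X]} (hg : IsApolar φ d a (q * g))
    (hh : IsApolar φ d b (q * h)) (hcop : IsCoprime g h) (hg0 : g ≠ 0)
    (hga : g.natDegree + e = a) (hhb : h.natDegree + e ≤ b) (hab : a + b ≤ d + 1 + e) :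
    IsApolar φ d e q := by
  intro u hu
  obtain ⟨α, β, h1⟩ := hcop
  set β' := (β * u) % g with hβ'
  set α' := α * u + (β * u) / g * h with hα'
  have hu' : u = α' * g + β' * h := by
    have h2 : g * ((β * u) / g) + β' = β * u := EuclideanDomain.div_add_mod _ _
    calc u = (α * g + β * h) * u := by rw [h1, one_mul]
      _ = α * u * g + (β * u) * h := by ring
      _ = α' * g + β' * h := by rw [← h2, hα']; ring
  have hβ0 : β' = 0 ∨ β'.natDegree + 1 ≤ g.natDegree := by
    by_cases hg1 : g.natDegree = 0
    · left
      have : IsUnit g := by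
        rw [Polynomial.isUnit_iff_degree_eq_zero, degree_eq_natDegree hg0, hg1]; rfl
      exact EuclideanDomain.mod_eq_zero.mpr this.dvd
    · right
      exact natDegree_mod_lt _ hg1
  have hβφ : φ (q * h * β') = 0 := by
    rcases hβ0 with h0 | h0
    · rw [h0, mul_zero, map_zero]
    · exact hh _ (by omega)
  have hdeg : (α' * g).natDegree + e ≤ d := by
    have h3 : α' * g = u - β' * h := by rw [hu']; ring
    rw [h3]
    have h4 : (β' * h).natDegree + e ≤ d := by
      rcases hβ0 with h0 | h0
      · rw [h0, zero_mul, natDegree_zero]; omega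
      · have := natDegree_mul_le (p := β') (q := h)
        omega
    have := natDegree_sub_le u (β' * h)
    omega
  have hαφ : φ (q * g * α') = 0 := by
    by_cases h0 : α' = 0
    · rw [h0, mul_zero, map_zero]
    · rw [natDegree_mul h0 hg0] at hdeg
      exact hg _ (by omega)
  have h5 : q * u = q * g * α' + q * h * β' := by rw [hu']; ring
  rw [h5, map_add, hαφ, hβφ, add_zero]

/-- The greatest common divisor of two apolar forms is apolar if their degrees are small. -/
theorem IsApolar.gcd_apolar {a b : ℕ} {g h : ℂ[X]} (hg : IsApolar φ d a g) (hh : IsApolar φ d b h)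
    (hg0 : g ≠ 0) (hh0 : h ≠ 0) (hga : g.natDegree ≤ a) (hhb : h.natDegree ≤ b) {e : ℕ}
    (he : e = (gcd g h).natDegree + min (a - g.natDegree) (b - h.natDegree))
    (hab : a + b ≤ d + 1 + e) : IsApolar φ d e (gcd g h) := by
  obtain ⟨g', hg'⟩ := gcd_dvd_left g h
  obtain ⟨h', hh'⟩ := gcd_dvd_right g h
  have hq0 : gcd g h ≠ 0 := fun h0 => hg0 (by rw [hg', h0, zero_mul])
  have hg'0 : g' ≠ 0 := fun h0 => hg0 (by rw [hg', h0, mul_zero])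
  have hh'0 : h' ≠ 0 := fun h0 => hh0 (by rw [hh', h0, mul_zero])
  have hcop : IsCoprime g' h' := by
    rw [← gcd_isUnit_iff]
    have h1 : gcd g h * gcd g' h' ∣ gcd g h * 1 := by
      rw [mul_one]
      refine dvd_gcd ?_ ?_
      · conv_rhs => rw [hg']
        exact mul_dvd_mul_left _ (gcd_dvd_left _ _)
      · conv_rhs => rw [hh']
        exact mul_dvd_mul_left _ (gcd_dvd_right _ _)
    exact isUnit_of_dvd_one ((mul_dvd_mul_iff_left hq0).mp h1)
  have e1 : g.natDegree = (gcd g h).natDegree + g'.natDegree := by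
    conv_lhs => rw [hg', natDegree_mul hq0 hg'0]
  have e2 : h.natDegree = (gcd g h).natDegree + h'.natDegree := by
    conv_lhs => rw [hh', natDegree_mul hq0 hh'0]
  have hg2 : IsApolar φ d a (gcd g h * g') := hg' ▸ hg
  have hh2 : IsApolar φ d b (gcd g h * h') := hh' ▸ hh
  -- The form with the smaller degree drop has a cofactor that does not vanish at infinity; it plays
  -- the role of the divisor.
  rcases le_total (a - g.natDegree) (b - h.natDegree) with hm | hm
  · rw [min_eq_left hm] at he
    exact hg2.of_isCoprime hh2 hcop hg'0 (by omega) (by omega) hab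
  · rw [min_eq_right hm] at he
    exact hh2.of_isCoprime hg2 hcop.symm hh'0 (by omega) (by omega) (by omega)

/-- There are no nonzero apolar forms of degree less than `r`. -/
def ApolarBound (φ : ℂ[X] →ₗ[ℂ] ℂ) (d r : ℕ) : Prop :=
  ∀ k < r, ∀ g : ℂ[X], g ≠ 0 → g.natDegree ≤ k → ¬ IsApolar φ d k g

/-- The gcd is apolar, so by minimality its degree is at least `r`, hence it is all of `g`. The
second conclusion is divisibility at infinity: the degree drop of `g` is at most that of `h`. -/
theorem ApolarBound.dvd {r b : ℕ} (hr : ApolarBound φ d r) {g h : ℂ[X]} (hg : IsApolar φ d r g)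
    (hh : IsApolar φ d b h) (hg0 : g ≠ 0) (hh0 : h ≠ 0) (hga : g.natDegree ≤ r)
    (hhb : h.natDegree ≤ b)
    (hrb : r + b ≤ d + 1 ∨ (r + b ≤ d + 2 ∧ ∃ p, IsFormRoot r g p ∧ IsFormRoot b h p)) :
    g ∣ h ∧ h.natDegree + r ≤ b + g.natDegree := by
  have hq0 : gcd g h ≠ 0 := fun h0 => hg0 (by simpa [h0] using gcd_dvd_left g h)
  have hle : (gcd g h).natDegree ≤ g.natDegree := natDegree_le_of_dvd (gcd_dvd_left g h) hg0
  -- A common root makes the gcd of positive degree, which relaxes the bound from `d + 1` to `d +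
  -- 2`.
  have hab : r + b ≤ d + 1 + ((gcd g h).natDegree + min (r - g.natDegree) (b - h.natDegree)) := by
    rcases hrb with h1 | ⟨h1, p, h2, h3⟩
    · omega
    · have : 1 ≤ (gcd g h).natDegree + min (r - g.natDegree) (b - h.natDegree) := by
        cases p with
        | none => simp only [IsFormRoot] at h2 h3; omega
        | some t =>
          have h4 : X - C t ∣ gcd g h := dvd_gcd (dvd_iff_isRoot.mpr h2) (dvd_iff_isRoot.mpr h3)
          have := natDegree_le_of_dvd h4 hq0
          rw [natDegree_X_sub_C] at this
          omega
      omega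
  have hap := hg.gcd_apolar hh hg0 hh0 hga hhb rfl hab
  have hge : r ≤ (gcd g h).natDegree + min (r - g.natDegree) (b - h.natDegree) := by
    by_contra hlt
    exact hr _ (not_le.mp hlt) _ hq0 (by omega) hap
  have heq : (gcd g h).natDegree = g.natDegree := by omega
  refine ⟨?_, by omega⟩
  obtain ⟨w, hw⟩ := gcd_dvd_left g h
  have hw0 : w ≠ 0 := fun h0 => hg0 (by rw [hw, h0, mul_zero])
  have hwd : w.natDegree = 0 := by
    have : g.natDegree = (gcd g h).natDegree + w.natDegree := by
      conv_lhs => rw [hw, natDegree_mul hq0 hw0]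
    omega
  have hwu : IsUnit w := by
    rw [Polynomial.isUnit_iff_degree_eq_zero, degree_eq_natDegree hw0, hwd]; rfl
  have : g ∣ gcd g h := by
    conv_lhs => rw [hw]
    exact (hwu.mul_right_dvd).mpr dvd_rfl
  exact this.trans (gcd_dvd_right g h)

end Apolar

/-! ### Forms with distinct roots -/

theorem rootForm_monic (A : Finset (Option ℂ)) : (rootForm A).Monic :=
  monic_prod_of_monic _ _ fun t _ => monic_X_sub_C t

theorem natDegree_rootForm (A : Finset (Option ℂ)) : (rootForm A).natDegree = A.eraseNone.card := by
  rw [rootForm, natDegree_prod_of_monic _ _ fun t _ => monic_X_sub_C t]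
  simp

theorem card_eraseNone_of_mem {A : Finset (Option ℂ)} (h : none ∈ A) :
    A.eraseNone.card + 1 = A.card := by
  classical
  rw [Finset.card_eraseNone_eq_card_erase, Finset.card_erase_add_one h]

theorem card_eraseNone_of_notMem {A : Finset (Option ℂ)} (h : none ∉ A) :
    A.eraseNone.card = A.card := by
  classical
  rw [Finset.card_eraseNone_eq_card_erase, Finset.erase_eq_of_notMem h]

theorem natDegree_rootForm_le (A : Finset (Option ℂ)) : (rootForm A).natDegree ≤ A.card := by
  rw [natDegree_rootForm]
  by_cases h : none ∈ A
  · have := card_eraseNone_of_mem h; omega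
  · exact (card_eraseNone_of_notMem h).le

theorem isFormRoot_rootForm {A : Finset (Option ℂ)} {p : Option ℂ} :
    IsFormRoot A.card (rootForm A) p ↔ p ∈ A := by
  cases p with
  | none =>
    rw [IsFormRoot, natDegree_rootForm]
    by_cases h : none ∈ A
    · have := card_eraseNone_of_mem h
      simp only [h, iff_true]; omega
    · have := card_eraseNone_of_notMem h
      simp only [h, iff_false]; omega
  | some t =>
    simp [IsFormRoot, rootForm, IsRoot, eval_prod, Finset.prod_eq_zero_iff, sub_eq_zero]

theorem rootForm_squarefree (A : Finset (Option ℂ)) : Squarefree (rootForm A) := by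
  refine Separable.squarefree ?_
  exact separable_prod_X_sub_C_iff'.mpr (fun x _ y _ h => h)

/-- A divisor of a form with distinct roots has distinct roots; `hd` is the comparison of
multiplicities at infinity. -/
theorem not_isFormDoubleRoot_of_dvd {A : Finset (Option ℂ)} {r : ℕ} {g : ℂ[X]} {p : Option ℂ}
    (hg : g ∣ rootForm A) (hd : (rootForm A).natDegree + r ≤ A.card + g.natDegree) :
    ¬ IsFormDoubleRoot r g p := by
  intro h
  cases p with
  | none =>
    simp only [IsFormDoubleRoot] at h
    have h1 := natDegree_rootForm A
    by_cases hn : none ∈ A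
    · have := card_eraseNone_of_mem hn; omega
    · have := card_eraseNone_of_notMem hn; omega
  | some t =>
    have h1 : (X - C t) * (X - C t) ∣ rootForm A := by
      rw [← pow_two]; exact h.trans hg
    exact not_isUnit_X_sub_C t (rootForm_squarefree A _ h1)

/-- A form without multiple roots is a multiple of the form of its set of roots. -/
theorem exists_rootForm {r : ℕ} {g : ℂ[X]} (hg0 : g ≠ 0) (hg : g.natDegree ≤ r)
    (h : ∀ p, ¬ IsFormDoubleRoot r g p) :
    ∃ A : Finset (Option ℂ), A.card = r ∧ ∃ c : ℂ, c ≠ 0 ∧ g = c • rootForm A := by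
  classical
  have hnd : g.roots.Nodup := by
    rw [Multiset.nodup_iff_count_le_one]
    intro t
    rw [count_roots]
    by_contra hlt
    exact h (some t) ((le_rootMultiplicity_iff hg0).mp (by omega))
  have hsplit := IsAlgClosed.splits g
  have hcard : g.roots.card = g.natDegree := (splits_iff_card_roots.mp hsplit)
  have hprod : g = C g.leadingCoeff * (g.roots.map fun a => X - C a).prod :=
    hsplit.eq_prod_roots
  have hlc : g.leadingCoeff ≠ 0 := leadingCoeff_ne_zero.mpr hg0
  have hprod' : g = g.leadingCoeff • ∏ t ∈ g.roots.toFinset, (X - C t) := by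
    rw [smul_eq_C_mul]
    conv_lhs => rw [hprod]
    rw [Finset.prod_eq_multiset_prod, Multiset.toFinset_val, hnd.dedup]
  have hcard' : g.roots.toFinset.card = g.natDegree := by
    rw [Multiset.toFinset_card_of_nodup hnd, hcard]
  have hinf := h none
  simp only [IsFormDoubleRoot] at hinf
  rcases (show g.natDegree = r ∨ g.natDegree + 1 = r by omega) with h1 | h1
  · refine ⟨g.roots.toFinset.map Function.Embedding.some, by simp [hcard', h1], _, hlc, ?_⟩
    rw [rootForm, Finset.eraseNone_map_some]
    exact hprod'
  · refine ⟨Finset.insertNone g.roots.toFinset, by simp [hcard', h1], _, hlc, ?_⟩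
    rw [rootForm, Finset.eraseNone_insertNone]
    exact hprod'

end

noncomputable section
open Polynomial

/-! ### Sylvester's theory: apolar forms of least and of complementary degree -/

section Sylvester

variable {φ : ℂ[X] →ₗ[ℂ] ℂ} {d : ℕ}

/-- For `k > d` the truncated subtraction gives no conditions, in agreement with `IsApolar`, which
is then vacuous. -/
theorem isApolar_iff_X_pow {k : ℕ} {g : ℂ[X]} :
    IsApolar φ d k g ↔ ∀ j < d + 1 - k, φ (g * X ^ j) = 0 := by
  refine ⟨fun h j hj => h _ (by rw [natDegree_X_pow]; omega), fun h u hu => ?_⟩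
  rw [u.as_sum_range_C_mul_X_pow, Finset.mul_sum, map_sum]
  refine Finset.sum_eq_zero fun j hj => ?_
  have hj' := Finset.mem_range.mp hj
  rw [← smul_eq_C_mul, mul_smul_comm, map_smul, h j (by omega), smul_zero]

/-- Apolar forms with prescribed vanishing coefficients exist by a dimension count. -/
theorem exists_isApolar (φ : ℂ[X] →ₗ[ℂ] ℂ) {d k : ℕ} (S : Finset ℕ)
    (h : (d + 1 - k) + S.card < k + 1) :
    ∃ g : ℂ[X], g ≠ 0 ∧ g.natDegree ≤ k ∧ IsApolar φ d k g ∧ ∀ i ∈ S, g.coeff i = 0 := by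
  let T : degreeLT ℂ (k + 1) →ₗ[ℂ] (Fin (d + 1 - k) → ℂ) × (S → ℂ) :=
    LinearMap.prod
      (LinearMap.pi fun j => φ ∘ₗ (LinearMap.mulRight ℂ (X ^ (j : ℕ))) ∘ₗ Submodule.subtype _)
      (LinearMap.pi fun i => lcoeff ℂ i ∘ₗ Submodule.subtype _)
  have : FiniteDimensional ℂ (degreeLT ℂ (k + 1)) := (degreeLTEquiv ℂ (k + 1)).symm.finiteDimensional
  have hker : LinearMap.ker T ≠ ⊥ := by
    apply LinearMap.ker_ne_bot_of_finrank_lt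
    rw [(degreeLTEquiv ℂ (k + 1)).finrank_eq]
    simpa using h
  obtain ⟨⟨g, hg⟩, hgT, hg0⟩ := Submodule.exists_mem_ne_zero_of_ne_bot hker
  have hg0' : g ≠ 0 := fun h0 => hg0 (Subtype.ext h0)
  rw [LinearMap.mem_ker, Prod.ext_iff] at hgT
  refine ⟨g, hg0', ?_, ?_, ?_⟩
  · have := mem_degreeLT.mp hg
    rw [degree_eq_natDegree hg0'] at this
    have := WithBot.coe_lt_coe.mp this
    exact Nat.lt_succ_iff.mp (by exact_mod_cast this)
  · rw [isApolar_iff_X_pow]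
    intro j hj
    exact congrFun hgT.1 ⟨j, hj⟩
  · intro i hi
    exact congrFun hgT.2 ⟨i, hi⟩

theorem exists_linear_comb_eq_zero {a b a' b' : ℂ} (h : a * b' = a' * b) :
    ∃ x y : ℂ, (x ≠ 0 ∨ y ≠ 0) ∧ x * a + y * b = 0 ∧ x * a' + y * b' = 0 := by
  by_cases h1 : a = 0 ∧ b = 0
  · by_cases h2 : a' = 0 ∧ b' = 0
    · exact ⟨1, 0, by simp, by simp [h1], by simp [h2]⟩
    · refine ⟨b', -a', ?_, by rw [h1.1, h1.2]; ring, by ring⟩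
      by_contra! h3
      exact h2 ⟨neg_eq_zero.mp h3.2, h3.1⟩
  · refine ⟨b, -a, ?_, by ring, by linear_combination -h⟩
    by_contra! h3
    exact h1 ⟨neg_eq_zero.mp h3.2, h3.1⟩

theorem sq_dvd_of_isRoot_derivative {g : ℂ[X]} {t : ℂ} (h : g.IsRoot t)
    (h' : (derivative g).IsRoot t) : (X - C t) ^ 2 ∣ g := by
  by_cases h0 : g = 0
  · rw [h0]; exact dvd_zero _
  · exact (le_rootMultiplicity_iff h0).mp ((one_lt_rootMultiplicity_iff_isRoot h0).mpr ⟨h, h'⟩)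

theorem isRoot_derivative_of_sq_dvd {g : ℂ[X]} {t : ℂ} (h : (X - C t) ^ 2 ∣ g) :
    g.IsRoot t ∧ (derivative g).IsRoot t := by
  obtain ⟨w, rfl⟩ := h
  constructor <;> simp [derivative_mul, derivative_pow]

/-- With `r = n + 2`, the terms of degree `2 * r - 1` cancel, so the Wronskian is a form of degree
`2 * r - 2`. Its top coefficient is its value at infinity. -/
theorem coeff_wronskian {n : ℕ} {a b : ℂ[X]} (ha : a.natDegree ≤ n + 2)
    (hb : b.natDegree ≤ n + 2) :
    (derivative a * b - a * derivative b).coeff (2 * n + 2) =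
      a.coeff (n + 2) * b.coeff (n + 1) - a.coeff (n + 1) * b.coeff (n + 2) := by
  have key : ∀ p : ℂ[X], p.natDegree ≤ n + 2 → ∃ q : ℂ[X], q.natDegree ≤ n + 1 ∧
      p = C (p.coeff (n + 2)) * X ^ (n + 2) + q ∧ q.coeff (n + 1) = p.coeff (n + 1) := by
    intro p hp
    refine ⟨p - C (p.coeff (n + 2)) * X ^ (n + 2), ?_, by ring, ?_⟩
    · rw [natDegree_le_iff_coeff_eq_zero]
      intro N hN
      rw [coeff_sub, coeff_C_mul, coeff_X_pow]
      split_ifs with h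
      · rw [h]; ring
      · rw [coeff_eq_zero_of_natDegree_lt (by omega)]; ring
    · rw [coeff_sub, coeff_C_mul, coeff_X_pow, if_neg (by omega)]; ring
  obtain ⟨p, hp, hap, hpc⟩ := key a ha
  obtain ⟨q, hq, hbq, hqc⟩ := key b hb
  rw [← hpc, ← hqc]
  generalize a.coeff (n + 2) = α at *
  generalize b.coeff (n + 2) = β at *
  have hpd : (derivative p).natDegree ≤ n := (natDegree_derivative_le p).trans (by omega)
  have hqd : (derivative q).natDegree ≤ n := (natDegree_derivative_le q).trans (by omega)
  have hpq : (derivative p * q - p * derivative q).coeff (2 * n + 2) = 0 := by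
    apply coeff_eq_zero_of_natDegree_lt
    have h1 := natDegree_mul_le (p := derivative p) (q := q)
    have h2 := natDegree_mul_le (p := p) (q := derivative q)
    have h3 := natDegree_sub_le (derivative p * q) (p * derivative q)
    omega
  have hX : derivative (X ^ (n + 2) : ℂ[X]) = C ((n : ℂ) + 2) * X ^ (n + 1) := by
    rw [derivative_X_pow]; push_cast; simp
  have hexp : derivative a * b - a * derivative b =
      C (α * (n + 2)) * (X ^ (n + 1) * q) - C α * (X ^ (n + 2) * derivative q)
      - C (β * (n + 2)) * (X ^ (n + 1) * p) + C β * (X ^ (n + 2) * derivative p)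
      + (derivative p * q - p * derivative q) := by
    rw [hap, hbq]
    simp only [derivative_add, derivative_mul, derivative_C, hX, C_mul]
    ring
  have c1 : ∀ s : ℂ[X], (X ^ (n + 1) * s).coeff (2 * n + 2) = s.coeff (n + 1) := fun s => by
    rw [show 2 * n + 2 = (n + 1) + (n + 1) by ring, coeff_X_pow_mul]
  have c2 : ∀ s : ℂ[X], (X ^ (n + 2) * derivative s).coeff (2 * n + 2) =
      s.coeff (n + 1) * (n + 1) := fun s => by
    rw [show 2 * n + 2 = n + (n + 2) by ring, coeff_X_pow_mul, coeff_derivative]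
  rw [hexp, coeff_add, hpq, coeff_add, coeff_sub, coeff_sub, coeff_C_mul, coeff_C_mul, coeff_C_mul,
    coeff_C_mul, c1, c1, c2, c2]
  ring

/-- A pencil of binary forms of degree at least two has a member with a multiple root. -/
theorem exists_isFormDoubleRoot_of_pencil {r : ℕ} (hr : 2 ≤ r) {a b : ℂ[X]} (ha : a.natDegree ≤ r)
    (hb : b.natDegree ≤ r) :
    ∃ (x y : ℂ) (p : Option ℂ), (x ≠ 0 ∨ y ≠ 0) ∧ IsFormDoubleRoot r (x • a + y • b) p := by
  obtain ⟨n, rfl⟩ := Nat.exists_eq_add_of_le' hr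
  -- `hD` says that the Wronskian vanishes at infinity: some member then loses its two top
  -- coefficients. Otherwise the Wronskian has positive degree and a finite root `t`, where some
  -- member vanishes together with its derivative.
  by_cases hD : a.coeff (n + 2) * b.coeff (n + 1) = a.coeff (n + 1) * b.coeff (n + 2)
  · obtain ⟨x, y, hxy, h1, h2⟩ := exists_linear_comb_eq_zero hD
    refine ⟨x, y, none, hxy, ?_⟩
    have : (x • a + y • b).natDegree ≤ n := by
      rw [natDegree_le_iff_coeff_eq_zero]
      intro N hN
      rw [coeff_add, coeff_smul, coeff_smul, smul_eq_mul, smul_eq_mul]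
      rcases (show N = n + 1 ∨ N = n + 2 ∨ n + 2 < N by omega) with rfl | rfl | h3
      · exact h2
      · exact h1
      · rw [coeff_eq_zero_of_natDegree_lt (by omega), coeff_eq_zero_of_natDegree_lt (by omega)]
        ring
    simp only [IsFormDoubleRoot]; omega
  · have hc := coeff_wronskian ha hb
    have hc0 : (derivative a * b - a * derivative b).coeff (2 * n + 2) ≠ 0 := by
      rw [hc]; exact sub_ne_zero.mpr hD
    have hdeg := le_natDegree_of_ne_zero hc0
    obtain ⟨t, ht⟩ := IsAlgClosed.exists_root (derivative a * b - a * derivative b) (by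
      intro h0
      have h1 : (derivative a * b - a * derivative b).natDegree = 0 :=
        natDegree_eq_of_degree_eq_some h0
      omega)
    rw [IsRoot, eval_sub, eval_mul, eval_mul, sub_eq_zero] at ht
    obtain ⟨x, y, hxy, h1, h2⟩ := exists_linear_comb_eq_zero ht.symm
    refine ⟨x, y, some t, hxy, sq_dvd_of_isRoot_derivative ?_ ?_⟩
    · simpa [IsRoot] using h1
    · simpa [IsRoot] using h2

/-- A base point free pencil of binary forms has a member without multiple roots. -/
theorem exists_rootForm_of_pencil {n : ℕ} (hn : 1 ≤ n) {a b : ℂ[X]} (hab : IsCoprime a b)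
    (ha : a.natDegree ≤ n) (hb : b.natDegree ≤ n) (hdeg : a.natDegree = n ∨ b.natDegree = n) :
    ∃ (t : ℂ) (A : Finset (Option ℂ)), A.card = n ∧ ∃ c : ℂ, c ≠ 0 ∧ a + t • b = c • rootForm A := by
  classical
  set w := derivative a * b - a * derivative b with hw
  -- If the Wronskian vanished, coprimality would give that each of `a` and `b` divides its own
  -- derivative, so both would be constant.
  have hw0 : w ≠ 0 := by
    intro h0
    have h1 : derivative a * b = a * derivative b := sub_eq_zero.mp h0
    have key : ∀ p q : ℂ[X], IsCoprime p q → p ∣ derivative p * q → p.natDegree = 0 := by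
      intro p q hpq hdvd
      have h2 : p ∣ derivative p := hpq.dvd_of_dvd_mul_right hdvd
      by_contra h3
      have h4 : derivative p ≠ 0 := fun h5 => h3 (derivative_eq_zero.mp h5)
      have := natDegree_le_of_dvd h2 h4
      have := natDegree_derivative_lt h3
      omega
    have h2 := key a b hab (h1 ▸ dvd_mul_right _ _)
    have h3 := key b a hab.symm (by rw [mul_comm, ← h1]; exact dvd_mul_left _ _)
    omega
  -- A double root `q` of `a + t • b` is a root of the Wronskian and determines `t`. The first entry
  -- excludes a degree drop, hence any root at infinity. Where a denominator is zero, the junk value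
  -- only excludes one more parameter.
  let bad : Finset ℂ := insert (-(a.coeff n) / b.coeff n)
    (w.roots.toFinset.image fun q => -(a.eval q) / b.eval q)
  obtain ⟨t, ht⟩ := Infinite.exists_notMem_finset bad
  rw [Finset.mem_insert, not_or] at ht
  have hlead : (a + t • b).coeff n ≠ 0 := by
    rw [coeff_add, coeff_smul, smul_eq_mul]
    intro h0
    by_cases hb0 : b.coeff n = 0
    · rw [hb0, mul_zero, add_zero] at h0
      rcases hdeg with h | h
      · have : a = 0 := by
          rw [← leadingCoeff_eq_zero, leadingCoeff, h, h0]
        rw [this, natDegree_zero] at h; omega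
      · have : b = 0 := by
          rw [← leadingCoeff_eq_zero, leadingCoeff, h, hb0]
        rw [this, natDegree_zero] at h; omega
    · apply ht.1
      field_simp
      linear_combination h0
  have hP0 : a + t • b ≠ 0 := fun h => hlead (by rw [h, coeff_zero])
  have hPle : (a + t • b).natDegree ≤ n :=
    (natDegree_add_le _ _).trans (max_le ha ((natDegree_smul_le _ _).trans hb))
  have hPn : n ≤ (a + t • b).natDegree := le_natDegree_of_ne_zero hlead
  refine ⟨t, exists_rootForm hP0 hPle ?_⟩
  intro p hp
  cases p with
  | none => simp only [IsFormDoubleRoot] at hp; omega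
  | some q =>
    obtain ⟨h1, h2⟩ := isRoot_derivative_of_sq_dvd hp
    simp only [IsRoot, eval_add, eval_smul, smul_eq_mul, derivative_add, derivative_smul] at h1 h2
    have hwq : w.eval q = 0 := by
      rw [hw, eval_sub, eval_mul, eval_mul]
      linear_combination b.eval q * h2 - (derivative b).eval q * h1
    apply ht.2
    rw [Finset.mem_image]
    refine ⟨q, by simp [hw0, hwq], ?_⟩
    have hbq : b.eval q ≠ 0 := by
      intro hb0
      rw [hb0, mul_zero, add_zero] at h1
      obtain ⟨x, y, hxy⟩ := hab
      have := congrArg (eval q) hxy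
      simp [h1, hb0] at this
    field_simp
    linear_combination -h1

theorem isCoprime_of_forall_not_isRoot {a b : ℂ[X]} (h : ∀ t, a.IsRoot t → ¬ b.IsRoot t) :
    IsCoprime a b := by
  rw [← gcd_isUnit_iff]
  by_contra hu
  have h0 : (gcd a b).degree ≠ 0 := fun h0 => hu (Polynomial.isUnit_iff_degree_eq_zero.mpr h0)
  obtain ⟨t, ht⟩ := IsAlgClosed.exists_root _ h0
  have hd := dvd_iff_isRoot.mpr ht
  exact h t (dvd_iff_isRoot.mp (hd.trans (gcd_dvd_left _ _)))
    (dvd_iff_isRoot.mp (hd.trans (gcd_dvd_right _ _)))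

/-- If `r` is the least degree of a nonzero apolar form, there is an apolar form of the
complementary degree `d + 2 - r` without multiple roots. -/
theorem ApolarBound.exists_rootForm {r : ℕ} (hr : ApolarBound φ d r) (hr1 : 1 ≤ r)
    (hrd : 2 * r ≤ d + 2) {g : ℂ[X]} (hg0 : g ≠ 0) (hgr : g.natDegree ≤ r)
    (hg : IsApolar φ d r g) :
    ∃ A : Finset (Option ℂ), A.card = d + 2 - r ∧ IsApolar φ d A.card (rootForm A) := by
  obtain ⟨m, hm⟩ : ∃ m, m + r = d + 2 - r := ⟨d + 2 - r - r, by omega⟩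
  -- A multiple `g * u` of degree `d + 2 - r` has `u` of degree at most `m`, so its leading
  -- coefficient has an index in this interval. Killing these coefficients prevents `h` from being a
  -- multiple of `g`; the dimension count leaves exactly one dimension to spare.
  obtain ⟨h, hh0, hhd, hh, hcoef⟩ := exists_isApolar φ (d := d) (k := d + 2 - r)
    (Finset.Icc g.natDegree (g.natDegree + m)) (by rw [Nat.card_Icc]; omega)
  have hno : ∀ p, IsFormRoot r g p → ¬ IsFormRoot (d + 2 - r) h p := by
    intro p hp hp'
    obtain ⟨⟨u, hu⟩, hle⟩ := hr.dvd hg hh hg0 hh0 hgr hhd (Or.inr ⟨by omega, p, hp, hp'⟩)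
    have hu0 : u ≠ 0 := fun h0 => hh0 (by rw [hu, h0, mul_zero])
    have hdeg : h.natDegree = g.natDegree + u.natDegree := by rw [hu, natDegree_mul hg0 hu0]
    have := hcoef h.natDegree (by rw [Finset.mem_Icc]; omega)
    rw [coeff_natDegree, leadingCoeff_eq_zero] at this
    exact hh0 this
  -- The factor `(X - C s) ^ m` raises `g` to degree `d + 2 - r` without creating a base point with
  -- `h`.
  obtain ⟨s, hs⟩ := Infinite.exists_notMem_finset h.roots.toFinset
  have hs' : h.eval s ≠ 0 := by simpa [hh0] using hs
  have hcop : IsCoprime h (g * (X - C s) ^ m) := by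
    refine IsCoprime.mul_right ?_ (IsCoprime.pow_right ?_)
    · exact (isCoprime_of_forall_not_isRoot fun t => hno (some t)).symm
    · refine isCoprime_of_forall_not_isRoot fun t ht ht' => hs' ?_
      rw [IsRoot, eval_sub, eval_X, eval_C, sub_eq_zero] at ht'
      rw [← ht']; exact ht
  have hdegB : (g * (X - C s) ^ m).natDegree = g.natDegree + m := by
    rw [natDegree_mul hg0 (pow_ne_zero _ (X_sub_C_ne_zero s)), natDegree_pow, natDegree_X_sub_C,
      mul_one]
  have hinf := hno none
  simp only [IsFormRoot] at hinf
  obtain ⟨t, A, hA, c, hc, hAc⟩ := exists_rootForm_of_pencil (n := d + 2 - r) (by omega) hcop hhd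
    (by omega) (by omega)
  refine ⟨A, hA, ?_⟩
  have h1 : IsApolar φ d A.card (h + t • (g * (X - C s) ^ m)) := by
    rw [hA]
    exact hh.add ((hg.mul (by rw [natDegree_pow, natDegree_X_sub_C]; omega)).smul t)
  have h2 := h1.smul c⁻¹
  rwa [hAc, smul_smul, inv_mul_cancel₀ hc, one_smul] at h2

theorem exists_apolarBound (φ : ℂ[X] →ₗ[ℂ] ℂ) (d : ℕ) : ∃ r, ApolarBound φ d r ∧ 2 * r ≤ d + 2 ∧
    ∃ g : ℂ[X], g ≠ 0 ∧ g.natDegree ≤ r ∧ IsApolar φ d r g := by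
  classical
  have hex : ∀ k, d < 2 * k → ∃ g : ℂ[X], g ≠ 0 ∧ g.natDegree ≤ k ∧ IsApolar φ d k g := by
    intro k hk
    obtain ⟨g, h1, h2, h3, -⟩ := exists_isApolar φ (d := d) (k := k) ∅ (by simp; omega)
    exact ⟨g, h1, h2, h3⟩
  have hP : ∃ k, ∃ g : ℂ[X], g ≠ 0 ∧ g.natDegree ≤ k ∧ IsApolar φ d k g := ⟨d + 1, hex _ (by omega)⟩
  refine ⟨Nat.find hP, ?_, ?_, Nat.find_spec hP⟩
  · intro k hk g h1 h2 h3
    exact Nat.find_min hP hk ⟨g, h1, h2, h3⟩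
  · have := Nat.find_min' hP (hex (d / 2 + 1) (by omega))
    omega

theorem pos_of_isApolar {r : ℕ} (hφ : ∃ h : ℂ[X], h.natDegree ≤ d ∧ φ h ≠ 0) {g : ℂ[X]}
    (hg0 : g ≠ 0) (hgr : g.natDegree ≤ r) (hg : IsApolar φ d r g) : 1 ≤ r := by
  by_contra hr
  obtain rfl : r = 0 := by omega
  obtain ⟨h, hh, hφh⟩ := hφ
  obtain ⟨c, rfl⟩ : ∃ c, g = C c := ⟨_, eq_C_of_natDegree_le_zero hgr⟩
  have hc : c ≠ 0 := fun h0 => hg0 (by rw [h0, C_0])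
  have := hg h (by omega)
  rw [← smul_eq_C_mul, map_smul, smul_eq_mul] at this
  exact hφh ((mul_eq_zero.mp this).resolve_left hc)

/-- A common root would force `g` to divide a form with distinct roots. This is what makes multiple
roots forbidden. -/
theorem ApolarBound.notMem_of_isFormDoubleRoot {r : ℕ} (hr : ApolarBound φ d r) {g : ℂ[X]}
    (hg0 : g ≠ 0) (hgr : g.natDegree ≤ r) (hg : IsApolar φ d r g) {p : Option ℂ}
    (hp : IsFormDoubleRoot r g p) {A : Finset (Option ℂ)} (hA : IsApolar φ d A.card (rootForm A))
    (hcard : r + A.card ≤ d + 2) : p ∉ A := by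
  intro hpA
  obtain ⟨h1, h2⟩ := hr.dvd hg hA hg0 (rootForm_monic A).ne_zero hgr (natDegree_rootForm_le A)
    (Or.inr ⟨hcard, p, hp.isFormRoot, isFormRoot_rootForm.mpr hpA⟩)
  exact not_isFormDoubleRoot_of_dvd h1 h2 hp

/-- Some point lies in no minimal set of points whose form is apolar. -/
theorem exists_notMem_of_isApolar_rootForm (hd : 1 ≤ d)
    (hφ : ∃ h : ℂ[X], h.natDegree ≤ d ∧ φ h ≠ 0) {s : ℕ}
    (hs : ∀ A : Finset (Option ℂ), IsApolar φ d A.card (rootForm A) → s ≤ A.card)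
    {A₀ : Finset (Option ℂ)} (hA₀ : A₀.card = s) (hA₀' : IsApolar φ d A₀.card (rootForm A₀)) :
    ∃ p : Option ℂ, ∀ A : Finset (Option ℂ), A.card = s → IsApolar φ d A.card (rootForm A) →
      p ∉ A := by
  classical
  obtain ⟨r, hr, hrd, g, hg0, hgr, hg⟩ := exists_apolarBound φ d
  have hr1 := pos_of_isApolar hφ hg0 hgr hg
  have hrs : r ≤ s := by
    by_contra hlt
    exact hr s (not_le.mp hlt) _ (rootForm_monic A₀).ne_zero
      (hA₀ ▸ natDegree_rootForm_le A₀) (hA₀ ▸ hA₀')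
  have hsr : r + s ≤ d + 2 := by
    obtain ⟨A, hA, hA'⟩ := hr.exists_rootForm hr1 hrd hg0 hgr hg
    have := hs A hA'
    omega
  -- If `r < s`, then `g` must have a multiple root, since otherwise its roots would be a smaller
  -- decomposition.
  rcases hrs.lt_or_eq with hlt | rfl
  · obtain ⟨p, hp⟩ : ∃ p, IsFormDoubleRoot r g p := by
      by_contra! hno
      obtain ⟨A, hA, c, hc, hgA⟩ := _root_.exists_rootForm hg0 hgr hno
      have h2 := hg.smul c⁻¹
      rw [hgA, smul_smul, inv_mul_cancel₀ hc, one_smul, ← hA] at h2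
      have := hs A h2
      omega
    exact ⟨p, fun A hA hA' => hr.notMem_of_isFormDoubleRoot hg0 hgr hg hp hA' (by omega)⟩
  · rcases hsr.lt_or_eq with hlt | heq
    -- Here `2 * r ≤ d + 1`, so any two apolar root forms of degree `r` divide each other: every
    -- minimal set lies in `A₀`, and any point outside it works.
    · obtain ⟨t, ht⟩ := Infinite.exists_notMem_finset A₀.eraseNone
      refine ⟨some t, fun A hA hA' hmem => ht ?_⟩
      obtain ⟨h1, -⟩ := hr.dvd (hA ▸ hA') hA₀' (rootForm_monic A).ne_zero
        (rootForm_monic A₀).ne_zero (hA ▸ natDegree_rootForm_le A) (natDegree_rootForm_le A₀)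
        (Or.inl (by omega))
      have h2 : X - C t ∣ rootForm A := dvd_iff_isRoot.mpr (isFormRoot_rootForm (p := some t).mpr hmem)
      have h3 : IsFormRoot A₀.card (rootForm A₀) (some t) := dvd_iff_isRoot.mp (h2.trans h1)
      rw [isFormRoot_rootForm] at h3
      simpa using h3
    -- Here `2 * r = d + 2`, and there is a second apolar form of degree `r`. The vanishing
    -- coefficient at `g.natDegree` makes it independent of `g`. A member of the pencil with a
    -- multiple root again has least degree.
    · obtain ⟨h, hh0, hhr, hh, hcoef⟩ := exists_isApolar φ (d := d) (k := r) {g.natDegree}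
        (by simp; omega)
      have hcoef' := hcoef _ (Finset.mem_singleton_self _)
      obtain ⟨x, y, p, hxy, hp⟩ := exists_isFormDoubleRoot_of_pencil (by omega) hgr hhr
      have hne : x • g + y • h ≠ 0 := by
        intro h0
        have h1 := congrArg (fun q => coeff q g.natDegree) h0
        simp only [coeff_add, coeff_smul, smul_eq_mul, hcoef', mul_zero, add_zero, coeff_zero,
          coeff_natDegree, mul_eq_zero, leadingCoeff_eq_zero, hg0, or_false] at h1
        rw [h1, zero_smul, zero_add, smul_eq_zero] at h0
        rcases hxy with h2 | h2
        · exact h2 h1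
        · exact h0.elim h2 hh0
      have hle : (x • g + y • h).natDegree ≤ r := (natDegree_add_le _ _).trans
        (max_le ((natDegree_smul_le _ _).trans hgr) ((natDegree_smul_le _ _).trans hhr))
      exact ⟨p, fun A hA hA' => hr.notMem_of_isFormDoubleRoot hne hle ((hg.smul x).add (hh.smul y))
        hp hA' (by omega)⟩

/-! ### Apolar squares and maximal rank -/

/-- The square of the linear form with root `p`. -/
def squareForm : Option ℂ → ℂ[X]
  | none => 1
  | some t => (X - C t) ^ 2

theorem exists_squareForm_of_isFormDoubleRoot {g : ℂ[X]} (hg0 : g ≠ 0) (hg2 : g.natDegree ≤ 2)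
    {p : Option ℂ} (hp : IsFormDoubleRoot 2 g p) : ∃ c : ℂ, c ≠ 0 ∧ g = c • squareForm p := by
  cases p with
  | none =>
    simp only [IsFormDoubleRoot] at hp
    have h := eq_C_of_natDegree_le_zero (p := g) (by omega)
    refine ⟨g.coeff 0, fun h0 => hg0 (by rw [h, h0, C_0]), ?_⟩
    rw [squareForm, smul_eq_C_mul, mul_one]
    exact h
  | some t =>
    obtain ⟨w, rfl⟩ := hp
    have hw0 : w ≠ 0 := fun h0 => hg0 (by rw [h0, mul_zero])
    rw [natDegree_mul (pow_ne_zero _ (X_sub_C_ne_zero t)) hw0, natDegree_pow,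
      natDegree_X_sub_C] at hg2
    have h := eq_C_of_natDegree_le_zero (p := w) (by omega)
    refine ⟨w.coeff 0, fun h0 => hw0 (by rw [h, h0, C_0]), ?_⟩
    rw [squareForm, smul_eq_C_mul, mul_comm, ← h]

/-- If no apolar form of degree less than `d` has distinct roots, some square is apolar. -/
theorem exists_isApolar_squareForm (hd : 2 ≤ d) (hφ : ∃ h : ℂ[X], h.natDegree ≤ d ∧ φ h ≠ 0)
    (hs : ∀ A : Finset (Option ℂ), IsApolar φ d A.card (rootForm A) → d ≤ A.card) :
    ∃ p, IsApolar φ d 2 (squareForm p) := by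
  rcases hd.lt_or_eq with hd3 | rfl
  · obtain ⟨r, hr, hrd, g, hg0, hgr, hg⟩ := exists_apolarBound φ d
    have hr1 := pos_of_isApolar hφ hg0 hgr hg
    -- There is an apolar form of degree `d + 2 - r` with distinct roots, so `d ≤ d + 2 - r`.
    have hr2 : r ≤ 2 := by
      obtain ⟨A, hA, hA'⟩ := hr.exists_rootForm hr1 hrd hg0 hgr hg
      have := hs A hA'
      omega
    obtain ⟨p, hp⟩ : ∃ p, IsFormDoubleRoot r g p := by
      by_contra! hno
      obtain ⟨A, hA, c, hc, hgA⟩ := _root_.exists_rootForm hg0 hgr hno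
      have h2 := hg.smul c⁻¹
      rw [hgA, smul_smul, inv_mul_cancel₀ hc, one_smul, ← hA] at h2
      have := hs A h2
      omega
    obtain rfl : r = 2 := by
      by_contra hne
      obtain rfl : r = 1 := by omega
      cases p with
      | none => simp only [IsFormDoubleRoot] at hp; omega
      | some t =>
        have := natDegree_le_of_dvd hp hg0
        rw [natDegree_pow, natDegree_X_sub_C] at this
        omega
    obtain ⟨c, hc, hgc⟩ := exists_squareForm_of_isFormDoubleRoot hg0 hgr hp
    have h2 := hg.smul c⁻¹
    rw [hgc, smul_smul, inv_mul_cancel₀ hc, one_smul] at h2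
    exact ⟨p, h2⟩
  -- For `d = 2`, a quadratic form is apolar as soon as `φ` kills it, and `φ ((X - t) ^ 2)` is a
  -- quadratic polynomial in `t`; when its leading coefficient `φ 1` vanishes, the root is at
  -- infinity.
  · have key : ∀ g : ℂ[X], φ g = 0 → IsApolar φ 2 2 g := by
      intro g hg
      rw [isApolar_iff_X_pow]
      intro j hj
      obtain rfl : j = 0 := by omega
      rw [pow_zero, mul_one, hg]
    by_cases h1 : φ 1 = 0
    · exact ⟨none, key _ h1⟩
    · obtain ⟨t, ht⟩ := IsAlgClosed.exists_root
        (C (φ 1) * X ^ 2 + C (-2 * φ X) * X + C (φ (X ^ 2))) (by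
          rw [degree_quadratic h1]; decide)
      refine ⟨some t, key _ ?_⟩
      have h2 : (X - C t) ^ 2 = X ^ 2 + (-2 * t) • X + (t ^ 2) • (1 : ℂ[X]) := by
        simp only [smul_eq_C_mul, C_mul, C_pow, C_neg, map_ofNat]
        ring
      rw [squareForm, h2, map_add, map_add, map_smul, map_smul, smul_eq_mul, smul_eq_mul]
      simp only [IsRoot, eval_add, eval_mul, eval_C, eval_pow, eval_X] at ht
      linear_combination ht

/-- If a square and a form with distinct roots, both vanishing at `p`, are apolar, then the linear
form with root `p` is apolar. -/
theorem isApolar_rootForm_singleton {p : Option ℂ} (hsq : IsApolar φ d 2 (squareForm p))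
    {A : Finset (Option ℂ)} (hA : IsApolar φ d A.card (rootForm A)) (hp : p ∈ A)
    (hcard : A.card ≤ d) : IsApolar φ d 1 (rootForm {p}) := by
  classical
  have hroot := isFormRoot_rootForm.mpr hp
  cases p with
  | none =>
    have hlt : (rootForm A).natDegree < A.card := hroot
    have h1 := natDegree_rootForm A
    have h2 := card_eraseNone_of_mem hp
    have he : rootForm {none} = 1 := by simp [rootForm]
    rw [he]
    -- The common linear factor is the one at infinity, invisible in the polynomials: `q = 1` has
    -- form degree `e = 1`. The degree condition is `A.card + 2 ≤ d + 2`.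
    refine IsApolar.of_isCoprime (q := 1) (g := rootForm A) (h := 1) (a := A.card) (b := 2)
      (by rwa [one_mul]) (by rwa [one_mul]) isCoprime_one_right (rootForm_monic A).ne_zero
      (by omega) (by simp) (by omega)
  | some t =>
    have he : rootForm {some t} = X - C t := by
      have : Finset.eraseNone {some t} = {t} := by ext x; simp
      rw [rootForm, this, Finset.prod_singleton]
    rw [he]
    obtain ⟨w, hw⟩ := dvd_iff_isRoot.mpr (hroot : (rootForm A).IsRoot t)
    have hw0 : w ≠ 0 := fun h0 => (rootForm_monic A).ne_zero (by rw [hw, h0, mul_zero])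
    have hdeg := natDegree_rootForm_le A
    rw [hw, natDegree_mul (X_sub_C_ne_zero t) hw0, natDegree_X_sub_C] at hdeg
    have hwt : ¬ w.IsRoot t := by
      intro h
      obtain ⟨v, hv⟩ := dvd_iff_isRoot.mpr h
      refine not_isUnit_X_sub_C t (rootForm_squarefree A _ ⟨v, ?_⟩)
      rw [hw, hv, mul_assoc]
    refine IsApolar.of_isCoprime (q := X - C t) (g := X - C t) (h := w) (a := 2) (b := A.card)
      (by rw [← pow_two]; exact hsq) (by rwa [← hw]) ?_ (X_sub_C_ne_zero t)
      (by rw [natDegree_X_sub_C]) (by omega) (by omega)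
    refine isCoprime_of_forall_not_isRoot fun s hs hs' => hwt ?_
    rw [IsRoot, eval_sub, eval_X, eval_C, sub_eq_zero] at hs
    rwa [← hs]

end Sylvester

end

noncomputable section
open MvPolynomial

/-! ### Forms on projective space -/

theorem MvPolynomial.IsHomogeneous.aeval_mul {σ R S : Type*} [CommRing R] [CommRing S] [Algebra R S]
    {g : MvPolynomial σ R} {n : ℕ} (hg : g.IsHomogeneous n) (t : S) (v : σ → S) :
    MvPolynomial.aeval (fun i => t * v i) g = t ^ n * MvPolynomial.aeval v g := by
  rw [aeval_def, aeval_def, eval₂_eq, eval₂_eq, Finset.mul_sum]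
  refine Finset.sum_congr rfl fun m hm => ?_
  rw [hg.degree_eq_sum_deg_support hm, ← Finset.prod_pow_eq_pow_sum]
  simp only [mul_pow, Finset.prod_mul_distrib]
  ring

section Forms

variable {N : ℕ}

theorem eval_smul_of_isHomogeneous {g : CoordRing N} {n : ℕ} (hg : g.IsHomogeneous n) (c : ℂ)
    (v : Fin (N + 1) → ℂ) : eval (c • v) g = c ^ n * eval v g := by
  have h := hg.aeval_mul c v
  rwa [aeval_eq_eval, aeval_eq_eval] at h

theorem vanishesAt_mk {g : CoordRing N} {n : ℕ} (hg : g.IsHomogeneous n)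
    {v : Fin (N + 1) → ℂ} (hv : v ≠ 0) :
    VanishesAt g (Projectivization.mk ℂ v hv) ↔ eval v g = 0 := by
  obtain ⟨a, ha⟩ := Projectivization.exists_smul_eq_mk_rep ℂ v hv
  rw [VanishesAt, ← ha, Units.smul_def, eval_smul_of_isHomogeneous hg, mul_eq_zero]
  exact or_iff_right (pow_ne_zero _ a.ne_zero)

/-- The linear form of a linear functional. -/
def linearForm (F : (Fin (N + 1) → ℂ) →ₗ[ℂ] ℂ) : CoordRing N :=
  ∑ i, C (F (Pi.single i 1)) * X i

theorem linearForm_isHomogeneous (F : (Fin (N + 1) → ℂ) →ₗ[ℂ] ℂ) :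
    (linearForm F).IsHomogeneous 1 :=
  IsHomogeneous.sum _ _ _ fun i _ => isHomogeneous_C_mul_X _ i

theorem eval_linearForm (F : (Fin (N + 1) → ℂ) →ₗ[ℂ] ℂ) (v : Fin (N + 1) → ℂ) :
    eval v (linearForm F) = F v := by
  rw [F.pi_apply_eq_sum_univ v, linearForm, map_sum]
  refine Finset.sum_congr rfl fun i _ => ?_
  rw [map_mul, eval_C, eval_X, smul_eq_mul, mul_comm]
  congr 2
  ext j
  simp [Pi.single_apply, eq_comm]

theorem exists_functional_of_isHomogeneous {g : CoordRing N} (hg : g.IsHomogeneous 1) :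
    ∃ F : (Fin (N + 1) → ℂ) →ₗ[ℂ] ℂ, ∀ v, eval v g = F v := by
  have h : g ∈ homogeneousSubmodule (Fin (N + 1)) ℂ 1 := hg
  rw [homogeneousSubmodule_one_eq_span_X] at h
  induction h using Submodule.span_induction with
  | mem x hx => obtain ⟨i, rfl⟩ := hx; exact ⟨LinearMap.proj i, fun v => by simp⟩
  | zero => exact ⟨0, fun v => by simp⟩
  | add x y hx hy h1 h2 =>
    rw [← homogeneousSubmodule_one_eq_span_X] at hx hy
    obtain ⟨F, hF⟩ := h1 hx
    obtain ⟨G, hG⟩ := h2 hy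
    exact ⟨F + G, fun v => by simp [hF, hG]⟩
  | smul a x hx h1 =>
    rw [← homogeneousSubmodule_one_eq_span_X] at hx
    obtain ⟨F, hF⟩ := h1 hx
    exact ⟨a • F, fun v => by simp [hF, smul_eval]⟩

theorem submodule_le_iSup_iff {f : PSpace N} {A : Finset (PSpace N)} :
    f.submodule ≤ ⨆ q ∈ A, q.submodule ↔
      ∀ F : (Fin (N + 1) → ℂ) →ₗ[ℂ] ℂ, (∀ q ∈ A, F q.rep = 0) → F f.rep = 0 := by
  have hle : ∀ (q : PSpace N) (P : Submodule ℂ (Fin (N + 1) → ℂ)), q.submodule ≤ P ↔ q.rep ∈ P := by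
    intro q P
    rw [Projectivization.submodule_eq, Submodule.span_singleton_le_iff_mem]
  rw [hle]
  constructor
  · intro h F hF
    have h1 : (⨆ q ∈ A, q.submodule) ≤ LinearMap.ker F :=
      iSup₂_le fun q hq => (hle q _).mpr (hF q hq)
    exact h1 h
  · intro h
    by_contra hn
    obtain ⟨F, hF, hker⟩ := Submodule.exists_le_ker_of_notMem hn
    exact hF (h F fun q hq => hker (Submodule.mem_iSup_of_mem q (Submodule.mem_iSup_of_mem hq
      ((hle q _).mp le_rfl))))

theorem exists_linearForm_separating {p q : PSpace N} (hpq : p ≠ q) :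
    ∃ g : CoordRing N, g.IsHomogeneous 1 ∧ eval p.rep g = 0 ∧ eval q.rep g ≠ 0 := by
  have h : q.rep ∉ Submodule.span ℂ {p.rep} := by
    intro h
    obtain ⟨a, ha⟩ := Submodule.mem_span_singleton.mp h
    apply hpq
    rw [← p.mk_rep, ← q.mk_rep, eq_comm, Projectivization.mk_eq_mk_iff']
    exact ⟨a, ha⟩
  obtain ⟨F, hF, hker⟩ := Submodule.exists_le_ker_of_notMem h
  refine ⟨linearForm F, linearForm_isHomogeneous F, ?_, ?_⟩
  · rw [eval_linearForm]
    exact hker (Submodule.mem_span_singleton_self _)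
  · rwa [eval_linearForm]

theorem exists_linearForm_ne_zero {v : Fin (N + 1) → ℂ} (hv : v ≠ 0) :
    ∃ g : CoordRing N, g.IsHomogeneous 1 ∧ eval v g ≠ 0 := by
  obtain ⟨i, hi⟩ := Function.ne_iff.mp hv
  exact ⟨X i, isHomogeneous_X _ i, by simpa using hi⟩

theorem exists_form_interpolating (B : Finset (PSpace N)) {n : ℕ} (hn : B.card ≤ n)
    (y : PSpace N → ℂ) :
    ∃ g : CoordRing N, g.IsHomogeneous n ∧ ∀ p ∈ B, eval p.rep g = y p := by
  classical
  have key : ∀ q ∈ B, ∃ g : CoordRing N, g.IsHomogeneous n ∧ eval q.rep g = 1 ∧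
      ∀ p ∈ B, p ≠ q → eval p.rep g = 0 := by
    intro q hq
    have h1 : ∀ p : PSpace N, ∃ g : CoordRing N, g.IsHomogeneous 1 ∧ eval q.rep g ≠ 0 ∧
        (p ≠ q → eval p.rep g = 0) := by
      intro p
      by_cases hpq : p = q
      · obtain ⟨g, h1, h2⟩ := exists_linearForm_ne_zero q.rep_nonzero
        exact ⟨g, h1, h2, fun h => absurd hpq h⟩
      · obtain ⟨g, h1, h2, h3⟩ := exists_linearForm_separating hpq
        exact ⟨g, h1, h3, fun _ => h2⟩
    choose g hg1 hg2 hg3 using h1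
    obtain ⟨m, rfl⟩ := Nat.exists_eq_add_of_le hn
    -- The factor at `p = q` is a linear form that does not vanish at `q`; it and the power of `g q`
    -- only adjust the degree to `n`.
    set h := (∏ p ∈ B, g p) * g q ^ m with hh
    have hh1 : h.IsHomogeneous (B.card + m) := by
      have h2 := (IsHomogeneous.prod B g (fun _ => 1) fun p _ => hg1 p).mul ((hg1 q).pow m)
      simpa using h2
    have hh2 : eval q.rep h ≠ 0 := by
      rw [hh, map_mul, map_prod, map_pow]
      exact mul_ne_zero (Finset.prod_ne_zero_iff.mpr fun p _ => hg2 p) (pow_ne_zero _ (hg2 q))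
    refine ⟨C (eval q.rep h)⁻¹ * h, hh1.C_mul _, ?_, ?_⟩
    · rw [map_mul, eval_C, inv_mul_cancel₀ hh2]
    · intro p hp hpq
      have h0 : eval p.rep h = 0 := by
        rw [hh, map_mul, map_prod, Finset.prod_eq_zero hp (hg3 p hpq), zero_mul]
      rw [map_mul, h0, mul_zero]
  choose! g hg1 hg2 hg3 using key
  refine ⟨∑ q ∈ B, C (y q) * g q, IsHomogeneous.sum _ _ _ fun q hq => (hg1 q hq).C_mul _, ?_⟩
  intro p hp
  rw [map_sum, Finset.sum_eq_single p]
  · rw [map_mul, eval_C, hg2 p hp, mul_one]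
  · intro q hq hqp
    rw [map_mul, hg3 q hq p hp hqp.symm, mul_zero]
  · exact fun h => absurd hp h

end Forms

/-! ### Hilbert functions -/

theorem finrank_map_add_finrank_inf_ker {K V W : Type*} [Field K] [AddCommGroup V] [Module K V]
    [AddCommGroup W] [Module K W] (P : Submodule K V) [FiniteDimensional K P] (e : V →ₗ[K] W) :
    Module.finrank K (P.map e) + Module.finrank K (P ⊓ LinearMap.ker e : Submodule K V) =
      Module.finrank K P := by
  have h := (e.domRestrict P).finrank_range_add_finrank_ker
  rw [LinearMap.range_domRestrict, LinearMap.ker_domRestrict] at h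
  rw [← h, ← Submodule.map_comap_subtype]
  congr 1
  exact Submodule.finrank_map_subtype_eq _ _

section

variable {K V U W : Type*} [Field K] [AddCommGroup V] [Module K V] [AddCommGroup U] [Module K U]
  [AddCommGroup W] [Module K W] {P : Submodule K V} [FiniteDimensional K P] {q : V →ₗ[K] U}
  {e : V →ₗ[K] W}

theorem finrank_le_finrank_map_of_ker_le (he : P.map e = ⊤) (h : P ⊓ LinearMap.ker q ≤ LinearMap.ker e) :
    Module.finrank K W ≤ Module.finrank K (P.map q) := by
  have h1 := finrank_map_add_finrank_inf_ker P q
  have h2 := finrank_map_add_finrank_inf_ker P e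
  rw [he, finrank_top] at h2
  have h3 := Submodule.finrank_mono (le_inf inf_le_left h :
    P ⊓ LinearMap.ker q ≤ P ⊓ LinearMap.ker e)
  omega

theorem inf_ker_le_ker_of_finrank_map_le (he : P.map e = ⊤)
    (h : P ⊓ LinearMap.ker q ≤ LinearMap.ker e)
    (hle : Module.finrank K (P.map q) ≤ Module.finrank K W) :
    P ⊓ LinearMap.ker e ≤ LinearMap.ker q := by
  have h1 := finrank_map_add_finrank_inf_ker P q
  have h2 := finrank_map_add_finrank_inf_ker P e
  rw [he, finrank_top] at h2
  rw [← Submodule.eq_of_le_of_finrank_le (le_inf inf_le_left h :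
    P ⊓ LinearMap.ker q ≤ P ⊓ LinearMap.ker e) (by omega)]
  exact inf_le_right

end

namespace ProjSubscheme

variable {N : ℕ}

instance finiteDimensional_homogeneousSubmodule (n : ℕ) :
    FiniteDimensional ℂ (homogeneousSubmodule (Fin (N + 1)) ℂ n) :=
  Module.Finite.iff_fg.mpr (homogeneousSubmodule_fg _ _ n)

variable {Z : ProjSubscheme N} {W : Type*} [AddCommGroup W] [Module ℂ W] {n : ℕ}
  {e : CoordRing N →ₗ[ℂ] W}

theorem finrank_le_hilbertFunction (he : ∀ w, ∃ g, g.IsHomogeneous n ∧ e g = w)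
    (hI : ∀ g ∈ Z.ideal, g.IsHomogeneous n → e g = 0) :
    Module.finrank ℂ W ≤ Z.hilbertFunction n :=
  finrank_le_finrank_map_of_ker_le
    (eq_top_iff.mpr fun w _ => let ⟨g, hg, hw⟩ := he w; ⟨g, hg, hw⟩)
    fun _ hg => hI _ (Ideal.Quotient.eq_zero_iff_mem.mp hg.2) hg.1

/-- The degree `n` part of the ideal lies in the kernel of `e`, and the bound on the Hilbert
function leaves no room for a strict inclusion. -/
theorem mem_ideal_of_hilbertFunction_le (he : ∀ w, ∃ g, g.IsHomogeneous n ∧ e g = w)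
    (hI : ∀ g ∈ Z.ideal, g.IsHomogeneous n → e g = 0)
    (hZ : Z.hilbertFunction n ≤ Module.finrank ℂ W) {g : CoordRing N} (hg : g.IsHomogeneous n)
    (hge : e g = 0) : g ∈ Z.ideal :=
  Ideal.Quotient.eq_zero_iff_mem.mp (inf_ker_le_ker_of_finrank_map_le
    (eq_top_iff.mpr fun w _ => let ⟨g, hg, hw⟩ := he w; ⟨g, hg, hw⟩)
    (q := (Ideal.Quotient.mkₐ ℂ Z.ideal).toLinearMap)
    (fun _ hg => hI _ (Ideal.Quotient.eq_zero_iff_mem.mp hg.2) hg.1) hZ ⟨hg, hge⟩)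

theorem hilbertFunction_eq (he : ∀ w, ∃ g, g.IsHomogeneous n ∧ e g = w)
    (hI : ∀ g, g.IsHomogeneous n → (g ∈ Z.ideal ↔ e g = 0)) :
    Z.hilbertFunction n = Module.finrank ℂ W := by
  have htop : (homogeneousSubmodule (Fin (N + 1)) ℂ n).map e = ⊤ :=
    eq_top_iff.mpr fun w _ => let ⟨g, hg, hw⟩ := he w; ⟨g, hg, hw⟩
  refine le_antisymm ?_ (finrank_le_hilbertFunction he fun g hg hgn => (hI g hgn).mp hg)
  have h1 := finrank_map_add_finrank_inf_ker (homogeneousSubmodule (Fin (N + 1)) ℂ n)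
    (Ideal.Quotient.mkₐ ℂ Z.ideal).toLinearMap
  have h2 := finrank_map_add_finrank_inf_ker (homogeneousSubmodule (Fin (N + 1)) ℂ n) e
  rw [htop, finrank_top] at h2
  have h3 := Submodule.finrank_mono (s := homogeneousSubmodule (Fin (N + 1)) ℂ n ⊓ LinearMap.ker e)
    (t := homogeneousSubmodule (Fin (N + 1)) ℂ n ⊓
      LinearMap.ker (Ideal.Quotient.mkₐ ℂ Z.ideal).toLinearMap)
    fun g hg => ⟨hg.1, Ideal.Quotient.eq_zero_iff_mem.mpr ((hI g hg.1).mpr hg.2)⟩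
  rw [hilbertFunction]
  omega

/-! ### Subschemes from points with values in an algebra -/

section OfPoint

variable {R : Type*} [CommRing R] [Algebra ℂ R]

theorem coeff_aeval_X_mul_C (v : Fin (N + 1) → R) (g : CoordRing N) (n : ℕ) :
    (aeval (fun i => Polynomial.X * Polynomial.C (v i)) g).coeff n =
      aeval v (homogeneousComponent n g) := by
  have key : ∀ m, ∀ h : CoordRing N, h.IsHomogeneous m →
      aeval (fun i => Polynomial.X * Polynomial.C (v i)) h =
        Polynomial.X ^ m * Polynomial.C (aeval v h) := by
    intro m h hh
    rw [hh.aeval_mul]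
    congr 1
    exact (comp_aeval_apply (φ := (Polynomial.CAlgHom : R →ₐ[R] _).restrictScalars ℂ) v h).symm
  conv_lhs => rw [← sum_homogeneousComponent g]
  rw [map_sum, Polynomial.finsetSum_coeff]
  have h1 : ∀ m ∈ Finset.range (g.totalDegree + 1),
      (aeval (fun i => Polynomial.X * Polynomial.C (v i)) (homogeneousComponent m g)).coeff n =
        if m = n then aeval v (homogeneousComponent n g) else 0 := by
    intro m _
    rw [key m _ (homogeneousComponent_isHomogeneous m g), mul_comm, Polynomial.coeff_C_mul,
      Polynomial.coeff_X_pow]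
    by_cases h : m = n
    · subst h; simp
    · rw [if_neg h, if_neg (Ne.symm h), mul_zero]
  rw [Finset.sum_congr rfl h1, Finset.sum_ite_eq']
  split_ifs with h
  · rfl
  · rw [homogeneousComponent_eq_zero, map_zero]
    rw [Finset.mem_range] at h
    omega

/-- The closed subscheme defined by the forms whose values at the algebra-valued point `v` lie in
the ideal `J`. -/
def ofPoint (v : Fin (N + 1) → R) (J : Ideal R) (hJ : ∀ x, (∀ i, v i * x ∈ J) → x ∈ J) :
    ProjSubscheme N where
  -- The extra variable records the degree: the coefficient of its `n`-th power is the value of the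
  -- degree `n` component at `v`. This makes the pullback of the extended ideal homogeneous.
  ideal := (J.map Polynomial.C).comap
    (aeval (fun i => Polynomial.X * Polynomial.C (v i)) : CoordRing N →ₐ[ℂ] Polynomial R)
  homogeneous := by
    intro g hg n
    rw [Ideal.mem_comap, Ideal.mem_map_C_iff] at hg ⊢
    intro m
    have h := hg m
    simp only [coeff_aeval_X_mul_C] at h ⊢
    rw [homogeneousComponent_of_mem (homogeneousComponent_isHomogeneous n g)]
    split_ifs with hmn
    · exact hmn ▸ h
    · rw [map_zero]; exact J.zero_mem
  saturated := by
    intro g hg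
    simp only [Ideal.mem_comap, Ideal.mem_map_C_iff] at hg ⊢
    intro n
    refine hJ _ fun i => ?_
    have h := hg i (n + 1)
    rwa [map_mul, aeval_X, mul_assoc, Polynomial.coeff_X_mul, Polynomial.coeff_C_mul] at h

variable {v : Fin (N + 1) → R} {J : Ideal R} {hJ : ∀ x, (∀ i, v i * x ∈ J) → x ∈ J}

theorem mem_ofPoint_iff {g : CoordRing N} :
    g ∈ (ofPoint v J hJ).ideal ↔ ∀ n, aeval v (homogeneousComponent n g) ∈ J := by
  rw [ofPoint, Ideal.mem_comap, Ideal.mem_map_C_iff]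
  simp only [coeff_aeval_X_mul_C]

theorem mem_ofPoint_iff_of_isHomogeneous {g : CoordRing N} {n : ℕ} (hg : g.IsHomogeneous n) :
    g ∈ (ofPoint v J hJ).ideal ↔ aeval v g ∈ J := by
  rw [mem_ofPoint_iff]
  constructor
  · intro h
    have := h n
    rwa [homogeneousComponent_eq_self hg] at this
  · intro h m
    rw [homogeneousComponent_of_mem hg]
    split_ifs
    · exact h
    · rw [map_zero]; exact J.zero_mem

end OfPoint

/-! ### Smooth subschemes and finite sets of points -/

/-- The reduced scheme of a finite set of points. -/
def ofFinset (A : Finset (PSpace N)) : ProjSubscheme N :=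
  ofPoint (R := A → ℂ) (fun i p => p.1.rep i) ⊥ fun x hx => by
    rw [Ideal.mem_bot]
    ext p
    obtain ⟨i, hi⟩ := Function.ne_iff.mp p.1.rep_nonzero
    have h := congrFun (Ideal.mem_bot.mp (hx i)) p
    exact (mul_eq_zero.mp h).resolve_left hi

theorem aeval_pi_apply {ι : Type*} (v : Fin (N + 1) → ι → ℂ) (g : CoordRing N) (p : ι) :
    aeval v g p = eval (fun i => v i p) g := by
  rw [← aeval_eq_eval]
  exact comp_aeval_apply (φ := Pi.evalAlgHom ℂ (fun _ : ι => ℂ) p) v g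

theorem mem_ofFinset_iff {A : Finset (PSpace N)} {g : CoordRing N} {n : ℕ}
    (hg : g.IsHomogeneous n) : g ∈ (ofFinset A).ideal ↔ ∀ p ∈ A, VanishesAt g p := by
  rw [ofFinset, mem_ofPoint_iff_of_isHomogeneous hg, Ideal.mem_bot]
  constructor
  · intro h p hp
    have := congrFun h ⟨p, hp⟩
    rwa [aeval_pi_apply] at this
  · intro h
    ext p
    rw [aeval_pi_apply]
    exact h p.1 p.2

theorem isReducedScheme_ofFinset (A : Finset (PSpace N)) : (ofFinset A).IsReducedScheme := by
  rw [IsReducedScheme, ofFinset, ofPoint]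
  refine Ideal.IsRadical.comap _ ?_
  rw [Ideal.map_bot]
  intro x hx
  obtain ⟨k, hk⟩ := hx
  rw [Ideal.mem_bot] at hk ⊢
  ext n p
  have h1 : (x.map (Pi.evalRingHom (fun _ : A => ℂ) p)) ^ k = 0 := by
    rw [← Polynomial.map_pow, hk, Polynomial.map_zero]
  have h2 := congrArg (fun y => y.coeff n) (eq_zero_of_pow_eq_zero h1)
  simpa using h2

theorem hasLength_ofFinset (A : Finset (PSpace N)) : (ofFinset A).HasLength A.card := by
  rw [HasLength, Filter.eventually_atTop]
  refine ⟨A.card, fun n hn => ?_⟩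
  rw [hilbertFunction_eq (W := A → ℂ)
    (e := LinearMap.pi fun p => (aeval p.1.rep : CoordRing N →ₐ[ℂ] ℂ).toLinearMap)]
  · simp
  · classical
    intro w
    obtain ⟨g, hg, hgw⟩ := exists_form_interpolating A hn
      (fun p => if h : p ∈ A then w ⟨p, h⟩ else 0)
    refine ⟨g, hg, ?_⟩
    ext p
    have := hgw p.1 p.2
    simpa [aeval_eq_eval] using this
  · intro g hg
    rw [mem_ofFinset_iff hg]
    constructor
    · intro h
      ext p
      simpa [aeval_eq_eval, VanishesAt] using h p.1 p.2
    · intro h p hp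
      simpa [aeval_eq_eval, VanishesAt] using congrFun h ⟨p, hp⟩

/-- Distinct points impose independent conditions on forms of large degree, so each contributes at
least one to the length. -/
theorem card_le_of_subset_support {s : ℕ} (hZ : Z.HasLength s) {B : Finset (PSpace N)}
    (hB : (B : Set (PSpace N)) ⊆ Z.support) : B.card ≤ s := by
  classical
  obtain ⟨n, hn⟩ := Filter.eventually_atTop.mp hZ
  have h := finrank_le_hilbertFunction (Z := Z) (n := max n B.card) (W := B → ℂ)
    (e := LinearMap.pi fun p => (aeval p.1.rep : CoordRing N →ₐ[ℂ] ℂ).toLinearMap) ?_ ?_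
  · rw [hn _ (le_max_left _ _)] at h
    simpa using h
  · intro w
    obtain ⟨g, hg, hgw⟩ := exists_form_interpolating B (le_max_right n _)
      (fun p => if h : p ∈ B then w ⟨p, h⟩ else 0)
    refine ⟨g, hg, ?_⟩
    ext p
    have := hgw p.1 p.2
    simpa [aeval_eq_eval] using this
  · intro g hg hgn
    ext p
    simpa [aeval_eq_eval, VanishesAt] using hB p.2 g hg _ hgn

/-- A form of positive degree that vanishes on the support of a smooth scheme lies in its ideal. -/
theorem IsReducedScheme.mem_ideal (hZ : Z.IsReducedScheme) {g : CoordRing N} {m : ℕ} (hm : 0 < m)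
    (hg : g.IsHomogeneous m) (h : ∀ p ∈ Z.support, VanishesAt g p) : g ∈ Z.ideal := by
  have h1 : g ∈ vanishingIdeal ℂ (zeroLocus ℂ Z.ideal) := by
    rw [mem_vanishingIdeal_iff]
    intro x hx
    rw [mem_zeroLocus_iff] at hx
    rw [aeval_eq_eval]
    -- The Nullstellensatz is applied on the affine cone, whose vertex is not a projective point;
    -- positive degree makes `g` vanish there.
    by_cases hx0 : x = 0
    · have := eval_smul_of_isHomogeneous hg 0 x
      rw [zero_smul, zero_pow hm.ne', zero_mul] at this
      rw [hx0]; exact this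
    · rw [← vanishesAt_mk hg hx0]
      refine h _ fun q hq n hqn => ?_
      rw [vanishesAt_mk hqn]
      have := hx q hq
      rwa [aeval_eq_eval] at this
  rw [vanishingIdeal_zeroLocus_eq_radical] at h1
  exact hZ.radical ▸ h1

end ProjSubscheme

/-- The forbidden locus in terms of finite sets of points. -/
theorem mem_forbiddenLocus_iff {N : ℕ} {X : Set (PSpace N)}
    (hX : ∀ p, (∀ (g : CoordRing N) (n : ℕ), g.IsHomogeneous n → (∀ q ∈ X, VanishesAt g q) →
      VanishesAt g p) → p ∈ X) {f l : PSpace N} :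
    l ∈ forbiddenLocus X f ↔ l ∈ X ∧ ∀ A : Finset (PSpace N), (A : Set (PSpace N)) ⊆ X →
      A.card = xRank X f → f.submodule ≤ ⨆ q ∈ A, q.submodule → l ∉ A := by
  refine and_congr_right fun _ => ⟨fun h A hA hcard hf hl => h ?_, ?_⟩
  · refine ⟨.ofFinset A, ?_, ?_, ProjSubscheme.isReducedScheme_ofFinset A, ?_, ?_⟩
    · intro g n hg hgX
      rw [ProjSubscheme.mem_ofFinset_iff hg]
      exact fun p hp => hgX p (hA hp)
    · rw [← hcard]
      exact ProjSubscheme.hasLength_ofFinset A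
    · intro g hg hg1
      rw [ProjSubscheme.mem_ofFinset_iff hg1] at hg
      obtain ⟨F, hF⟩ := exists_functional_of_isHomogeneous hg1
      rw [VanishesAt, hF]
      exact submodule_le_iSup_iff.mp hf F fun q hq => by rw [← hF]; exact hg q hq
    · intro g hg n hgn
      rw [ProjSubscheme.mem_ofFinset_iff hgn] at hg
      exact hg l hl
  · rintro h ⟨Z, hZX, hZs, hZr, hfZ, hlZ⟩
    have hfin : Z.support.Finite := by
      by_contra hinf
      obtain ⟨B, hB, hBc⟩ := Set.Infinite.exists_subset_card_eq hinf (xRank X f + 1)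
      have := ProjSubscheme.card_le_of_subset_support hZs hB
      omega
    have hsub : (hfin.toFinset : Set (PSpace N)) ⊆ X := by
      rw [hfin.coe_toFinset]
      intro p hp
      exact hX p fun g n hg hgX => hp g (hZX g n hg hgX) n hg
    have hspan : f.submodule ≤ ⨆ q ∈ hfin.toFinset, q.submodule := by
      rw [submodule_le_iSup_iff]
      intro F hF
      rw [← eval_linearForm]
      refine hfZ _ (hZr.mem_ideal one_pos (linearForm_isHomogeneous F) fun p hp => ?_)
        (linearForm_isHomogeneous F)
      rw [VanishesAt, eval_linearForm]
      exact hF p (hfin.mem_toFinset.mpr hp)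
    refine h hfin.toFinset hsub ?_ hspan (hfin.mem_toFinset.mpr hlZ)
    -- The support has at most `xRank X f` points by length, and at least as many because it spans
    -- `f`. Thus the number of points of a general smooth scheme need not be computed.
    refine le_antisymm (ProjSubscheme.card_le_of_subset_support hZs ?_) (Nat.sInf_le ?_)
    · rw [hfin.coe_toFinset]
    · exact ⟨_, hsub, rfl, hspan⟩

end

noncomputable section
open MvPolynomial

/-! ### The Veronese parametrization -/

/-- The coefficients of `(a x + b y) ^ d`. -/
def veronese {R : Type*} [CommRing R] (d : ℕ) (a b : R) : Fin (d + 1) → R :=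
  fun i => (d.choose i : R) * a ^ (d - (i : ℕ)) * b ^ (i : ℕ)

section Veronese

variable {R S : Type*} [CommRing R] [CommRing S] {d : ℕ}

theorem map_veronese (φ : R →+* S) (a b : R) (i : Fin (d + 1)) :
    φ (veronese d a b i) = veronese d (φ a) (φ b) i := by
  simp [veronese]

theorem veronese_mul (c a b : R) : veronese d (c * a) (c * b) = c ^ d • veronese d a b := by
  ext i
  have hi : c ^ d = c ^ (d - (i : ℕ)) * c ^ (i : ℕ) := by rw [← pow_add]; congr 1; omega
  simp only [veronese, Pi.smul_apply, smul_eq_mul, mul_pow, hi]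
  ring

theorem coeff_pair (c : ℂ) (j i : Fin (d + 1)) :
    coeff (Finsupp.single 0 (d - (i : ℕ)) + Finsupp.single 1 (i : ℕ))
      (C c * X 0 ^ (d - (j : ℕ)) * X 1 ^ (j : ℕ) : MvPolynomial (Fin 2) ℂ) =
      if i = j then c else 0 := by
  have h : (C c * X 0 ^ (d - (j : ℕ)) * X 1 ^ (j : ℕ) : MvPolynomial (Fin 2) ℂ) =
      monomial (Finsupp.single 0 (d - (j : ℕ)) + Finsupp.single 1 (j : ℕ)) c := by
    rw [X_pow_eq_monomial, X_pow_eq_monomial, mul_assoc, monomial_mul, C_mul_monomial]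
    simp
  rw [h, coeff_monomial]
  refine if_congr ⟨fun he => ?_, fun he => by rw [he]⟩ rfl rfl
  have := DFunLike.congr_fun he 1
  simp at this
  exact Fin.ext this.symm

theorem coeffVec_sum (c : Fin (d + 1) → ℂ) :
    coeffVec d (∑ j, C (c j) * X 0 ^ (d - (j : ℕ)) * X 1 ^ (j : ℕ)) = c := by
  ext i
  rw [coeffVec, coeff_sum]
  simp_rw [coeff_pair]
  simp

theorem isHomogeneous_sum_pair (c : Fin (d + 1) → ℂ) :
    (∑ j : Fin (d + 1), C (c j) * X 0 ^ (d - (j : ℕ)) * X 1 ^ (j : ℕ) :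
      MvPolynomial (Fin 2) ℂ).IsHomogeneous d := by
  refine IsHomogeneous.sum _ _ _ fun j _ => ?_
  have h := ((isHomogeneous_X_pow (R := ℂ) (0 : Fin 2) (d - (j : ℕ))).C_mul (c j)).mul
    (isHomogeneous_X_pow (R := ℂ) (1 : Fin 2) (j : ℕ))
  rwa [Nat.sub_add_cancel (by omega)] at h

theorem eq_sum_coeffVec {H : MvPolynomial (Fin 2) ℂ} (hH : H.IsHomogeneous d) :
    H = ∑ j : Fin (d + 1), C (coeffVec d H j) * X 0 ^ (d - (j : ℕ)) * X 1 ^ (j : ℕ) := by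
  rw [← sub_eq_zero]
  by_contra h0
  refine coeffVec_ne_zero (hH.sub (isHomogeneous_sum_pair _)) h0 ?_
  ext i
  have h1 := congrFun (coeffVec_sum (coeffVec d H)) i
  rw [coeffVec] at h1
  rw [coeffVec, coeff_sub, h1]
  simp [coeffVec]

theorem coeffVec_pow (a b : ℂ) :
    coeffVec d ((C a * X 0 + C b * X 1) ^ d) = veronese d a b := by
  have h : ((C a * X 0 + C b * X 1) ^ d : MvPolynomial (Fin 2) ℂ) =
      ∑ j : Fin (d + 1), C (veronese d a b j) * X 0 ^ (d - (j : ℕ)) * X 1 ^ (j : ℕ) := by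
    rw [add_comm, add_pow, Finset.sum_range]
    refine Finset.sum_congr rfl fun j _ => ?_
    simp only [veronese, C_mul, C_pow, mul_pow, map_natCast]
    ring
  rw [h, coeffVec_sum]

theorem exists_eq_linear {L : MvPolynomial (Fin 2) ℂ} (hL : L.IsHomogeneous 1) :
    ∃ a b : ℂ, L = C a * X 0 + C b * X 1 := by
  refine ⟨coeffVec 1 L 0, coeffVec 1 L 1, (eq_sum_coeffVec hL).trans ?_⟩
  rw [Fin.sum_univ_two]
  simp

theorem veronese_ne_zero {a b : ℂ} (h : a ≠ 0 ∨ b ≠ 0) : veronese d a b ≠ 0 := by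
  intro h0
  rcases h with h | h
  · have := congrFun h0 0
    simp [veronese, h] at this
  · have := congrFun h0 (Fin.last d)
    simp [veronese, h] at this

/-- A scalar multiple of `L ^ d` is again a `d`-th power, since `ℂ` contains `d`-th roots; hence
even the chosen representative is an exact `veronese` vector. -/
theorem mem_rationalNormalCurve_iff (hd : 1 ≤ d) {p : PSpace d} :
    p ∈ rationalNormalCurve d ↔ ∃ a b : ℂ, p.rep = veronese d a b := by
  constructor
  · rintro ⟨L, hL, hL0, rfl⟩
    obtain ⟨a, b, rfl⟩ := exists_eq_linear hL
    obtain ⟨u, hu⟩ := Projectivization.exists_smul_eq_mk_rep ℂ (coeffVec d ((C a * X 0 + C b * X 1) ^ d))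
      (coeffVec_ne_zero (by simpa using hL.pow d) (pow_ne_zero d hL0))
    obtain ⟨c, hc⟩ := IsAlgClosed.exists_pow_nat_eq (u : ℂ) (n := d) (by omega)
    refine ⟨c * a, c * b, ?_⟩
    rw [formPoint, ← hu, coeffVec_pow, veronese_mul, hc]
    rfl
  · rintro ⟨a, b, hab⟩
    have hne : a ≠ 0 ∨ b ≠ 0 := by
      by_contra! h
      apply p.rep_nonzero
      rw [hab, h.1, h.2]
      ext i
      have : d - (i : ℕ) ≠ 0 ∨ (i : ℕ) ≠ 0 := by omega
      rcases this with h | h <;> simp [veronese, h]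
    have hL : (C a * X 0 + C b * X 1 : MvPolynomial (Fin 2) ℂ).IsHomogeneous 1 :=
      (isHomogeneous_C_mul_X a 0).add (isHomogeneous_C_mul_X b 1)
    have hL0 : (C a * X 0 + C b * X 1 : MvPolynomial (Fin 2) ℂ) ≠ 0 := by
      intro h0
      rcases hne with h | h
      · exact h (by simpa using congrArg (eval ![1, 0]) h0)
      · exact h (by simpa using congrArg (eval ![0, 1]) h0)
    refine ⟨_, hL, hL0, ?_⟩
    rw [← p.mk_rep, formPoint]
    congr 1
    rw [hab, coeffVec_pow]

/-- The rational normal curve is cut out by quadrics. -/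
theorem mem_rationalNormalCurve_of_forall_vanishesAt (hd : 1 ≤ d) {p : PSpace d}
    (h : ∀ (g : CoordRing d) (n : ℕ), g.IsHomogeneous n →
      (∀ q ∈ rationalNormalCurve d, VanishesAt g q) → VanishesAt g p) :
    p ∈ rationalNormalCurve d := by
  have hch : ∀ i : ℕ, i ≤ d → (d.choose i : ℂ) ≠ 0 := fun i hi =>
    Nat.cast_ne_zero.mpr (Nat.choose_pos hi).ne'
  -- Dividing by the binomial coefficients turns the curve into `y i = a ^ (d - i) * b ^ i`, cut out
  -- by the minors in `hquad`. The value beyond index `d` is a dummy.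
  set y : ℕ → ℂ := fun i => if h : i < d + 1 then p.rep ⟨i, h⟩ / d.choose i else 0 with hy
  have hyv : ∀ i : Fin (d + 1), y i = p.rep i / d.choose i := fun i => by
    simp only [hy, dif_pos i.isLt]
  have hquad : ∀ i j, i < d → j < d → y i * y (j + 1) = y (i + 1) * y j := by
    intro i j hi hj
    let Y : Fin (d + 1) → CoordRing d := fun k => C (1 / (d.choose k : ℂ)) * X k
    have hY : ∀ k, (Y k).IsHomogeneous 1 := fun k => isHomogeneous_C_mul_X _ k
    have h1 := h (Y ⟨i, by omega⟩ * Y ⟨j + 1, by omega⟩ - Y ⟨i + 1, by omega⟩ * Y ⟨j, by omega⟩) 2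
      (((hY _).mul (hY _)).sub ((hY _).mul (hY _))) ?_
    · simp only [VanishesAt, Y, map_sub, map_mul, eval_C, eval_X] at h1
      have e1 := hyv ⟨i, by omega⟩
      have e2 := hyv ⟨j + 1, by omega⟩
      have e3 := hyv ⟨i + 1, by omega⟩
      have e4 := hyv ⟨j, by omega⟩
      simp only at e1 e2 e3 e4
      rw [e1, e2, e3, e4]
      linear_combination h1
    · intro q hq
      obtain ⟨a, b, hab⟩ := (mem_rationalNormalCurve_iff hd).mp hq
      obtain ⟨m, rfl⟩ : ∃ m, d = i + 1 + m := ⟨d - i - 1, by omega⟩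
      obtain ⟨k, hk⟩ : ∃ k, i + 1 + m = j + 1 + k := ⟨i + 1 + m - j - 1, by omega⟩
      simp only [VanishesAt, Y, map_sub, map_mul, eval_C, eval_X, hab, veronese]
      have c1 := hch i (by omega)
      have c2 := hch (j + 1) (by omega)
      have c3 := hch (i + 1) (by omega)
      have c4 := hch j (by omega)
      rw [show i + 1 + m - i = m + 1 by omega, show i + 1 + m - (j + 1) = k by omega,
        show i + 1 + m - (i + 1) = m by omega, show i + 1 + m - j = k + 1 by omega]
      field_simp
      ring
  rw [mem_rationalNormalCurve_iff hd]
  have hrep : ∀ a b : ℂ, (∀ i ≤ d, y i = a ^ (d - i) * b ^ i) → p.rep = veronese d a b := by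
    intro a b hab
    ext i
    have h1 := hyv i
    rw [hab i (by omega), eq_div_iff (hch i (by omega))] at h1
    rw [veronese, ← h1]
    ring
  -- The minors make `y` geometric when `y 0 ≠ 0`; when `y 0 = 0`, the relations `y (i + 1) ^ 2 = y
  -- i * y (i + 2)` kill everything before index `d`.
  by_cases h0 : y 0 = 0
  · have hz : ∀ i < d, y i = 0 := by
      intro i
      induction i with
      | zero => exact fun _ => h0
      | succ i ih =>
        intro hi
        have := hquad i (i + 1) (by omega) hi
        rw [ih (by omega), zero_mul] at this
        exact mul_self_eq_zero.mp this.symm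
    obtain ⟨b, hb⟩ := IsAlgClosed.exists_pow_nat_eq (y d) (n := d) (by omega)
    refine ⟨0, b, hrep _ _ fun i hi => ?_⟩
    rcases hi.lt_or_eq with hlt | rfl
    · rw [hz i hlt, zero_pow (by omega), zero_mul]
    · rw [Nat.sub_self, pow_zero, one_mul, hb]
  · obtain ⟨a, ha⟩ := IsAlgClosed.exists_pow_nat_eq (y 0) (n := d) (by omega)
    refine ⟨a, a * (y 1 / y 0), hrep _ _ fun i hi => ?_⟩
    have hg : ∀ i ≤ d, y i = y 0 * (y 1 / y 0) ^ i := by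
      intro i
      induction i with
      | zero => simp
      | succ i ih =>
        intro hi
        have := hquad 0 i (by omega) (by omega)
        rw [ih (by omega)] at this
        rw [pow_succ]
        field_simp at this ⊢
        rw [zero_add] at this
        linear_combination this
    rw [hg i hi, mul_pow, ← mul_assoc, ← pow_add, Nat.sub_add_cancel hi, ha]

/-- The linear form on the space of binary forms that restricts to `H` on the rational normal
curve. -/
def polarForm (d : ℕ) (H : MvPolynomial (Fin 2) ℂ) : CoordRing d :=
  ∑ i : Fin (d + 1), C (coeffVec d H i / d.choose i) * X i

theorem isHomogeneous_polarForm (H : MvPolynomial (Fin 2) ℂ) : (polarForm d H).IsHomogeneous 1 :=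
  IsHomogeneous.sum _ _ _ fun i _ => isHomogeneous_C_mul_X _ i

theorem aeval_polarForm [Algebra ℂ R] {H : MvPolynomial (Fin 2) ℂ} (hH : H.IsHomogeneous d)
    (a b : R) : aeval (veronese d a b) (polarForm d H) = aeval ![a, b] H := by
  conv_rhs => rw [eq_sum_coeffVec hH]
  rw [polarForm, map_sum, map_sum]
  refine Finset.sum_congr rfl fun i _ => ?_
  have hch : (d.choose i : ℂ) ≠ 0 := Nat.cast_ne_zero.mpr (Nat.choose_pos (by omega)).ne'
  simp only [map_mul, aeval_C, aeval_X, map_pow, veronese, Matrix.cons_val_zero,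
    Matrix.cons_val_one]
  have h1 : algebraMap ℂ R (coeffVec d H i / d.choose i) * (d.choose i : R) =
      algebraMap ℂ R (coeffVec d H i) := by
    rw [← map_natCast (algebraMap ℂ R), ← map_mul, div_mul_cancel₀ _ hch]
  rw [← h1]
  ring

end Veronese

end

noncomputable section
open MvPolynomial

/-! ### Tangent lines of the rational normal curve -/

/-- The point `(a + t a' : b + t b')` of the rational normal curve with values in polynomials in
`t`. -/
def veroneseArc (d : ℕ) (a b a' b' : ℂ) : Fin (d + 1) → Polynomial ℂ :=
  veronese d (Polynomial.C a + Polynomial.C a' * Polynomial.X)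
    (Polynomial.C b + Polynomial.C b' * Polynomial.X)

/-- The coefficient of `t ^ k` in `(L + t M) ^ d` for `L = a x + b y` and `M = a' x + b' y`. -/
def veroneseCoeff (d : ℕ) (a b a' b' : ℂ) (k : ℕ) : Fin (d + 1) → ℂ :=
  fun i => (veroneseArc d a b a' b' i).coeff k

section Tangent

variable {d : ℕ} {a b a' b' : ℂ}

theorem eval_veroneseArc (t : ℂ) (i : Fin (d + 1)) :
    (veroneseArc d a b a' b' i).eval t = veronese d (a + t * a') (b + t * b') i := by
  rw [veroneseArc, ← Polynomial.coe_evalRingHom, map_veronese]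
  simp only [Polynomial.coe_evalRingHom, Polynomial.eval_add, Polynomial.eval_mul,
    Polynomial.eval_C, Polynomial.eval_X, mul_comm t]

theorem natDegree_veroneseArc_le (i : Fin (d + 1)) : (veroneseArc d a b a' b' i).natDegree ≤ d := by
  have h : ∀ a a' : ℂ, (Polynomial.C a + Polynomial.C a' * Polynomial.X).natDegree ≤ 1 := by
    intro a a'
    rw [add_comm]
    exact Polynomial.natDegree_linear_le
  rw [veroneseArc, veronese, mul_assoc]
  refine (Polynomial.natDegree_mul_le).trans ?_
  rw [Polynomial.natDegree_natCast, zero_add]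
  refine (Polynomial.natDegree_mul_le).trans ?_
  have h1 := (Polynomial.natDegree_pow_le (p := Polynomial.C a + Polynomial.C a' * Polynomial.X)
    (n := d - (i : ℕ))).trans (Nat.mul_le_mul_left _ (h a a'))
  have h2 := (Polynomial.natDegree_pow_le (p := Polynomial.C b + Polynomial.C b' * Polynomial.X)
    (n := (i : ℕ))).trans (Nat.mul_le_mul_left _ (h b b'))
  omega

theorem veroneseCoeff_zero : veroneseCoeff d a b a' b' 0 = veronese d a b := by
  ext i
  rw [veroneseCoeff, Polynomial.coeff_zero_eq_eval_zero, eval_veroneseArc]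
  simp

theorem veronese_eq_sum_veroneseCoeff (t : ℂ) :
    veronese d (a + t * a') (b + t * b') =
      ∑ k ∈ Finset.range (d + 1), t ^ k • veroneseCoeff d a b a' b' k := by
  ext i
  rw [← eval_veroneseArc, Polynomial.eval_eq_sum_range' (n := d + 1)
    (Nat.lt_succ_of_le (natDegree_veroneseArc_le i)), Finset.sum_apply]
  refine Finset.sum_congr rfl fun k _ => ?_
  rw [Pi.smul_apply, smul_eq_mul, mul_comm, veroneseCoeff]

theorem eval_aeval_veroneseArc (t : ℂ) (g : CoordRing d) :
    (aeval (veroneseArc d a b a' b') g).eval t =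
      eval (veronese d (a + t * a') (b + t * b')) g := by
  have h := comp_aeval_apply (φ := (Polynomial.aeval t : Polynomial ℂ →ₐ[ℂ] ℂ))
    (veroneseArc d a b a' b') g
  rw [Polynomial.coe_aeval_eq_eval] at h
  rw [h, aeval_eq_eval]
  simp_rw [eval_veroneseArc]

theorem coeff_zero_aeval_veroneseArc (g : CoordRing d) :
    (aeval (veroneseArc d a b a' b') g).coeff 0 = eval (veronese d a b) g := by
  rw [Polynomial.coeff_zero_eq_eval_zero, eval_aeval_veroneseArc]
  simp

theorem coeff_aeval_veroneseArc {g : CoordRing d} (hg : g.IsHomogeneous 1) (k : ℕ) :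
    (aeval (veroneseArc d a b a' b') g).coeff k = eval (veroneseCoeff d a b a' b' k) g := by
  have h : g ∈ homogeneousSubmodule (Fin (d + 1)) ℂ 1 := hg
  rw [homogeneousSubmodule_one_eq_span_X] at h
  clear hg
  induction h using Submodule.span_induction with
  | mem x hx => obtain ⟨i, rfl⟩ := hx; simp [veroneseCoeff]
  | zero => simp
  | add x y _ _ h1 h2 => rw [map_add, map_add, Polynomial.coeff_add, h1, h2]
  | smul c x _ h1 => rw [map_smul, Polynomial.coeff_smul, h1, smul_eval, smul_eq_mul]

theorem natDegree_aeval_veroneseArc_le {g : CoordRing d} {n : ℕ} (hg : g.IsHomogeneous n) :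
    (aeval (veroneseArc d a b a' b') g).natDegree ≤ n * d :=
  aeval_natDegree_le g hg.totalDegree_le _ natDegree_veroneseArc_le

theorem exists_linearForm_aeval_eq_X_pow (hΔ : a * b' - a' * b ≠ 0) {j : ℕ} (hj : j ≤ d) :
    ∃ g : CoordRing d, g.IsHomogeneous 1 ∧
      aeval (veroneseArc d a b a' b') g = Polynomial.X ^ j := by
  set Δ := a * b' - a' * b with hΔ'
  -- The forms `l` and `m` are the dual basis: they take the values `1` and `t` along the arc `(a +
  -- t a', b + t b')`, so `l ^ (d - j) * m ^ j` takes the value `t ^ j`.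
  set l : MvPolynomial (Fin 2) ℂ := C (b' / Δ) * X 0 + C (-a' / Δ) * X 1 with hl
  set m : MvPolynomial (Fin 2) ℂ := C (-b / Δ) * X 0 + C (a / Δ) * X 1 with hm
  have hl1 : l.IsHomogeneous 1 := (isHomogeneous_C_mul_X _ _).add (isHomogeneous_C_mul_X _ _)
  have hm1 : m.IsHomogeneous 1 := (isHomogeneous_C_mul_X _ _).add (isHomogeneous_C_mul_X _ _)
  have hH : (l ^ (d - j) * m ^ j).IsHomogeneous d := by
    have := (hl1.pow (d - j)).mul (hm1.pow j)
    rwa [one_mul, one_mul, Nat.sub_add_cancel hj] at this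
  refine ⟨polarForm d (l ^ (d - j) * m ^ j), isHomogeneous_polarForm _, ?_⟩
  rw [veroneseArc, aeval_polarForm hH, map_mul, map_pow, map_pow]
  have el : aeval ![Polynomial.C a + Polynomial.C a' * Polynomial.X,
      Polynomial.C b + Polynomial.C b' * Polynomial.X] l = (1 : Polynomial ℂ) := by
    have h1 : b' / Δ * a + -a' / Δ * b = 1 := by field_simp; rw [hΔ']; ring
    have h2 : b' / Δ * a' + -a' / Δ * b' = 0 := by field_simp; ring
    have h3 : aeval ![Polynomial.C a + Polynomial.C a' * Polynomial.X,
      Polynomial.C b + Polynomial.C b' * Polynomial.X] l =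
        Polynomial.C (b' / Δ * a + -a' / Δ * b) +
        Polynomial.C (b' / Δ * a' + -a' / Δ * b') * Polynomial.X := by
      simp only [hl, map_add, map_mul, aeval_C, aeval_X, Matrix.cons_val_zero,
        Matrix.cons_val_one, Polynomial.algebraMap_eq]
      ring
    rw [h3, h1, h2, Polynomial.C_0, Polynomial.C_1, zero_mul, add_zero]
  have em : aeval ![Polynomial.C a + Polynomial.C a' * Polynomial.X,
      Polynomial.C b + Polynomial.C b' * Polynomial.X] m = (Polynomial.X : Polynomial ℂ) := by
    have h1 : -b / Δ * a + a / Δ * b = 0 := by field_simp; ring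
    have h2 : -b / Δ * a' + a / Δ * b' = 1 := by field_simp; rw [hΔ']; ring
    have h3 : aeval ![Polynomial.C a + Polynomial.C a' * Polynomial.X,
      Polynomial.C b + Polynomial.C b' * Polynomial.X] m =
        Polynomial.C (-b / Δ * a + a / Δ * b) +
        Polynomial.C (-b / Δ * a' + a / Δ * b') * Polynomial.X := by
      simp only [hm, map_add, map_mul, aeval_C, aeval_X, Matrix.cons_val_zero,
        Matrix.cons_val_one, Polynomial.algebraMap_eq]
      ring
    rw [h3, h1, h2, Polynomial.C_0, Polynomial.C_1, one_mul, zero_add]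
  rw [el, em, one_pow, one_mul]

theorem exists_form_aeval_eq_X_pow (hΔ : a * b' - a' * b ≠ 0) (n : ℕ) {k : ℕ} (hk : k ≤ n * d) :
    ∃ g : CoordRing d, g.IsHomogeneous n ∧
      aeval (veroneseArc d a b a' b') g = Polynomial.X ^ k := by
  induction n generalizing k with
  | zero =>
    obtain rfl : k = 0 := by omega
    exact ⟨1, isHomogeneous_one _ _, by simp⟩
  | succ n ih =>
    obtain ⟨j, m, hj, hm, rfl⟩ : ∃ j m, j ≤ d ∧ m ≤ n * d ∧ k = m + j := by
      rw [Nat.succ_mul] at hk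
      exact ⟨min k d, k - min k d, by omega, by omega, by omega⟩
    obtain ⟨g, hg, hgX⟩ := ih hm
    obtain ⟨h, hh, hhX⟩ := exists_linearForm_aeval_eq_X_pow hΔ hj
    exact ⟨g * h, hg.mul hh, by rw [map_mul, hgX, hhX, pow_add]⟩

/-- Projective normality of the rational normal curve: forms of degree `n` restrict onto all binary
forms of degree `n * d`. -/
theorem exists_form_aeval_eq (hΔ : a * b' - a' * b ≠ 0) {n : ℕ} {q : Polynomial ℂ} (hq : q.natDegree ≤ n * d) :
    ∃ g : CoordRing d, g.IsHomogeneous n ∧ aeval (veroneseArc d a b a' b') g = q := by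
  have h : ∀ k ∈ Finset.range (n * d + 1), ∃ g : CoordRing d, g.IsHomogeneous n ∧
      aeval (veroneseArc d a b a' b') g = Polynomial.X ^ k := fun k hk =>
    exists_form_aeval_eq_X_pow hΔ n (by rw [Finset.mem_range] at hk; omega)
  choose! g hg hgX using h
  refine ⟨∑ k ∈ Finset.range (n * d + 1), C (q.coeff k) * g k,
    IsHomogeneous.sum _ _ _ fun k hk => (hg k hk).C_mul _, ?_⟩
  rw [map_sum]
  conv_rhs => rw [q.as_sum_range_C_mul_X_pow' (Nat.lt_succ_of_le hq)]
  refine Finset.sum_congr rfl fun k hk => ?_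
  rw [map_mul, hgX k hk, aeval_C, Polynomial.algebraMap_eq]

theorem mk_veronese_mem_rationalNormalCurve (hd : 1 ≤ d) (hne : veronese d a b ≠ 0) :
    Projectivization.mk ℂ (veronese d a b) hne ∈ rationalNormalCurve d := by
  rw [mem_rationalNormalCurve_iff hd]
  obtain ⟨u, hu⟩ := Projectivization.exists_smul_eq_mk_rep ℂ _ hne
  obtain ⟨c, hc⟩ := IsAlgClosed.exists_pow_nat_eq (u : ℂ) (n := d) (by omega)
  exact ⟨_, _, by rw [← hu, Units.smul_def, ← hc, ← veronese_mul]⟩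

theorem aeval_veroneseArc_eq_zero_iff (hΔ : a * b' - a' * b ≠ 0) (hd : 1 ≤ d) {g : CoordRing d} {n : ℕ}
    (hg : g.IsHomogeneous n) :
    aeval (veroneseArc d a b a' b') g = 0 ↔ ∀ q ∈ rationalNormalCurve d, VanishesAt g q := by
  constructor
  · intro h q hq
    obtain ⟨α, β, hq⟩ := (mem_rationalNormalCurve_iff hd).mp hq
    rw [VanishesAt, hq]
    obtain ⟨x, y, rfl, rfl⟩ : ∃ x y, α = x * a + y * a' ∧ β = x * b + y * b' := by
      refine ⟨(α * b' - a' * β) / (a * b' - a' * b), (a * β - α * b) / (a * b' - a' * b), ?_, ?_⟩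
      · rw [div_mul_eq_mul_div, div_mul_eq_mul_div, ← add_div, eq_div_iff hΔ]; ring
      · rw [div_mul_eq_mul_div, div_mul_eq_mul_div, ← add_div, eq_div_iff hΔ]; ring
    -- The arc misses the point `(a', b')`. A second arc through the given point, in the direction
    -- `(a, b)`, meets the first chart for all `s ≠ -x`, so `g` vanishes along it identically and in
    -- particular at `s = 0`.
    have hP : aeval (veroneseArc d (x * a + y * a') (x * b + y * b') a b) g = 0 := by
      refine Polynomial.eq_zero_of_infinite_isRoot _ (Set.Infinite.mono (s := {-x}ᶜ) ?_
        (Set.finite_singleton (-x)).infinite_compl)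
      intro s hs
      have hs' : x + s ≠ 0 := fun h0 => hs (Set.mem_singleton_iff.mpr (by linear_combination h0))
      rw [Set.mem_ofPred_eq, Polynomial.IsRoot, eval_aeval_veroneseArc]
      have e1 : x * a + y * a' + s * a = (x + s) * (a + y / (x + s) * a') := by
        field_simp; ring
      have e2 : x * b + y * b' + s * b = (x + s) * (b + y / (x + s) * b') := by
        field_simp; ring
      rw [e1, e2, veronese_mul, eval_smul_of_isHomogeneous hg, ← eval_aeval_veroneseArc, h,
        Polynomial.eval_zero, mul_zero]
    rw [← coeff_zero_aeval_veroneseArc (a' := a) (b' := b), hP, Polynomial.coeff_zero]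
  · intro h
    refine Polynomial.funext fun t => ?_
    rw [eval_aeval_veroneseArc, Polynomial.eval_zero]
    have hne : veronese d (a + t * a') (b + t * b') ≠ 0 := by
      refine veronese_ne_zero ?_
      by_contra! h0
      apply hΔ
      linear_combination b' * h0.1 - a' * h0.2
    rw [← vanishesAt_mk hg hne]
    exact h _ (mk_veronese_mem_rationalNormalCurve hd hne)

/-- The subscheme of length two of the rational normal curve at the point `[(a x + b y) ^ d]`. -/
def doublePoint (hΔ : a * b' - a' * b ≠ 0) : ProjSubscheme d :=
  .ofPoint (veroneseArc d a b a' b') (Ideal.span {Polynomial.X ^ 2}) fun x hx => by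
    -- Some linear form has the value `1` along the arc, so the coordinates generate the unit ideal;
    -- this gives saturation.
    obtain ⟨g, hg, hg1⟩ := exists_linearForm_aeval_eq_X_pow hΔ (Nat.zero_le d)
    have key : ∀ h : CoordRing d, h.IsHomogeneous 1 →
        aeval (veroneseArc d a b a' b') h * x ∈ Ideal.span {(Polynomial.X : Polynomial ℂ) ^ 2} := by
      intro h hh
      have hmem : h ∈ homogeneousSubmodule (Fin (d + 1)) ℂ 1 := hh
      rw [homogeneousSubmodule_one_eq_span_X] at hmem
      clear hh
      induction hmem using Submodule.span_induction with
      | mem y hy => obtain ⟨i, rfl⟩ := hy; rw [aeval_X]; exact hx i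
      | zero => simp
      | add y z _ _ h1 h2 => rw [map_add, add_mul]; exact Ideal.add_mem _ h1 h2
      | smul c y _ h1 =>
        rw [map_smul, smul_mul_assoc, Polynomial.smul_eq_C_mul]
        exact Ideal.mul_mem_left _ _ h1
    have := key g hg
    rwa [hg1, pow_zero, one_mul] at this

theorem mem_doublePoint_iff (hΔ : a * b' - a' * b ≠ 0) {g : CoordRing d} {n : ℕ} (hg : g.IsHomogeneous n) :
    g ∈ (doublePoint hΔ).ideal ↔ Polynomial.X ^ 2 ∣ aeval (veroneseArc d a b a' b') g := by
  rw [doublePoint, ProjSubscheme.mem_ofPoint_iff_of_isHomogeneous hg, Ideal.mem_span_singleton]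

/-- The first order part of a form along an arc of the rational normal curve. -/
def firstOrder (d : ℕ) (a b a' b' : ℂ) : CoordRing d →ₗ[ℂ] ℂ × ℂ :=
  LinearMap.prod
    (Polynomial.lcoeff ℂ 0 ∘ₗ (aeval (veroneseArc d a b a' b')).toLinearMap)
    (Polynomial.lcoeff ℂ 1 ∘ₗ (aeval (veroneseArc d a b a' b')).toLinearMap)

theorem firstOrder_eq_zero_iff {g : CoordRing d} : firstOrder d a b a' b' g = 0 ↔
    Polynomial.X ^ 2 ∣ aeval (veroneseArc d a b a' b') g := by
  rw [Polynomial.X_pow_dvd_iff]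
  constructor
  · intro h k hk
    rw [firstOrder, Prod.ext_iff] at h
    interval_cases k
    · exact h.1
    · exact h.2
  · intro h
    exact Prod.ext (h 0 (by norm_num)) (h 1 (by norm_num))

theorem exists_firstOrder_eq (hΔ : a * b' - a' * b ≠ 0) (hd : 1 ≤ d) {n : ℕ} (hn : 1 ≤ n) (w : ℂ × ℂ) :
    ∃ g : CoordRing d, g.IsHomogeneous n ∧ firstOrder d a b a' b' g = w := by
  obtain ⟨g, hg, hgq⟩ := exists_form_aeval_eq hΔ (n := n)
    (q := Polynomial.C w.2 * Polynomial.X + Polynomial.C w.1)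
    (Polynomial.natDegree_linear_le.trans (Nat.mul_pos hn hd))
  refine ⟨g, hg, Prod.ext ?_ ?_⟩
  · change (aeval (veroneseArc d a b a' b') g).coeff 0 = w.1
    rw [hgq]; simp
  · change (aeval (veroneseArc d a b a' b') g).coeff 1 = w.2
    rw [hgq]; simp

theorem mem_ideal_of_forall_isHomogeneous_mul {Z : ProjSubscheme d} {g : CoordRing d} {m : ℕ}
    (h : ∀ u : CoordRing d, u.IsHomogeneous m → u * g ∈ Z.ideal) : g ∈ Z.ideal := by
  induction m with
  | zero => simpa using h 1 (isHomogeneous_one _ _)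
  | succ m ih =>
    refine ih fun u hu => Z.saturated _ fun i => ?_
    rw [← mul_assoc]
    exact h _ (add_comm m 1 ▸ (isHomogeneous_X ℂ i).mul hu)

/-- The Ranestad–Schreyer locus of length two consists of the points of tangency. -/
theorem mem_ranestadSchreyerLocus_iff (hΔ : a * b' - a' * b ≠ 0) (hd : 1 ≤ d) {f : PSpace d}
    (hne : veronese d a b ≠ 0) :
    Projectivization.mk ℂ (veronese d a b) hne ∈ ranestadSchreyerLocus (rationalNormalCurve d) f 2 ↔
      ∃ x y : ℂ, f.rep = x • veroneseCoeff d a b a' b' 0 + y • veroneseCoeff d a b a' b' 1 := by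
  have hlX := mk_veronese_mem_rationalNormalCurve hd hne
  generalize hl : Projectivization.mk ℂ (veronese d a b) hne = l at hlX ⊢
  have hvan : ∀ (g : CoordRing d) (n : ℕ), g.IsHomogeneous n → (VanishesAt g l ↔
      Polynomial.X ∣ aeval (veroneseArc d a b a' b') g) := by
    intro g n hg
    rw [Polynomial.X_dvd_iff, coeff_zero_aeval_veroneseArc, ← hl, vanishesAt_mk hg]
  constructor
  · rintro ⟨-, Z, hZX, hZ2, hfZ, hlZ, m, g, hg, ⟨k, u, v, hv, hvl, hvg⟩, hgerm⟩
    have hZv : ∀ (h : CoordRing d) (n : ℕ), h.IsHomogeneous n →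
        aeval (veroneseArc d a b a' b') h = 0 → h ∈ Z.ideal := fun h n hh h0 =>
      hZX h n hh ((aeval_veroneseArc_eq_zero_iff hΔ hd hh).mp h0)
    have hgl : VanishesAt g l := by
      have h1 := hlZ _ hvg (u + m * k) (hv.mul (hg.pow k))
      rw [VanishesAt, map_mul, map_pow] at h1
      exact eq_zero_of_pow_eq_zero ((mul_eq_zero.mp h1).resolve_left hvl)
    -- `Z` contains the double point at `l`: if some `h` in the ideal had only a simple zero along
    -- the arc, it would be a local parameter on `Z`, and every germ vanishing at `l`, in particular
    -- the nilpotent `g`, would be zero.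
    have hsub : ∀ h ∈ Z.ideal, ∀ n, h.IsHomogeneous n → firstOrder d a b a' b' h = 0 := by
      intro h hh n hhn
      rw [firstOrder_eq_zero_iff]
      by_contra hndvd
      obtain ⟨η, hη⟩ := (hvan h n hhn).mp (hlZ h hh n hhn)
      obtain ⟨γ, hγ⟩ := (hvan g m hg).mp hgl
      have hηX : ¬ Polynomial.X ∣ η := fun ⟨w, hw⟩ =>
        hndvd ⟨w, by rw [hη, hw, pow_two, mul_assoc]⟩
      have hdeg : ∀ (p q : Polynomial ℂ) (N : ℕ), p = Polynomial.X * q → p.natDegree ≤ N →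
          q.natDegree ≤ N := by
        intro p q N hpq hp
        rcases eq_or_ne q 0 with h0 | h0
        · rw [h0, Polynomial.natDegree_zero]; omega
        · rw [hpq, Polynomial.natDegree_mul Polynomial.X_ne_zero h0] at hp
          omega
      -- With `h = t η` and `g = t γ` along the arc, lift `η` and `γ` to forms `u'` and `w`. Then
      -- `u' * g - h * w` vanishes on the curve, so `u' * g` lies in the ideal, with `u'` nonzero at
      -- `l`.
      obtain ⟨u', hu', hu'η⟩ := exists_form_aeval_eq hΔ
        (hdeg _ _ _ hη (natDegree_aeval_veroneseArc_le hhn))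
      obtain ⟨w, hw, hwγ⟩ := exists_form_aeval_eq hΔ
        (hdeg _ _ _ hγ (natDegree_aeval_veroneseArc_le hg))
      refine hgerm ⟨n, u', hu', fun h0 => hηX ?_, ?_⟩
      · have := (hvan u' n hu').mp h0
        rwa [hu'η] at this
      · have h1 : u' * g - h * w ∈ Z.ideal := hZv _ (n + m) ((hu'.mul hg).sub (hhn.mul hw)) (by
          rw [map_sub, map_mul, map_mul, hu'η, hwγ, hη, hγ]; ring)
        have h2 := Z.ideal.add_mem h1 (Z.ideal.mul_mem_right w hh)
        rwa [sub_add_cancel] at h2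
    obtain ⟨n₀, hn₀⟩ := Filter.eventually_atTop.mp hZ2
    -- Length two forces the ideals of `Z` and of the double point to agree in large degree;
    -- saturation brings this down to linear forms.
    have hmem : ∀ h : CoordRing d, h.IsHomogeneous 1 → firstOrder d a b a' b' h = 0 →
        h ∈ Z.ideal := by
      intro h hh h0
      refine mem_ideal_of_forall_isHomogeneous_mul (m := n₀) fun u hu => ?_
      refine ProjSubscheme.mem_ideal_of_hilbertFunction_le (n := n₀ + 1)
        (e := firstOrder d a b a' b') (exists_firstOrder_eq hΔ hd (by omega))
        (fun g hg hgn => hsub g hg _ hgn) ?_ (hu.mul hh) ?_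
      · rw [hn₀ _ (by omega)]; simp
      · rw [firstOrder_eq_zero_iff] at h0 ⊢
        rw [map_mul]
        exact h0.mul_left _
    have hspan : f.rep ∈ Submodule.span ℂ
        {veroneseCoeff d a b a' b' 0, veroneseCoeff d a b a' b' 1} := by
      by_contra hn
      obtain ⟨F, hF, hker⟩ := Submodule.exists_le_ker_of_notMem hn
      apply hF
      rw [← eval_linearForm]
      refine hfZ _ (hmem _ (linearForm_isHomogeneous F) ?_) (linearForm_isHomogeneous F)
      refine Prod.ext ?_ ?_
      · refine (coeff_aeval_veroneseArc (linearForm_isHomogeneous F) 0).trans ?_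
        rw [eval_linearForm]
        exact hker (Submodule.subset_span (by simp))
      · refine (coeff_aeval_veroneseArc (linearForm_isHomogeneous F) 1).trans ?_
        rw [eval_linearForm]
        exact hker (Submodule.subset_span (by simp))
    obtain ⟨x, y, hxy⟩ := Submodule.mem_span_pair.mp hspan
    exact ⟨x, y, hxy.symm⟩
  · rintro ⟨x, y, hf⟩
    refine ⟨hlX, doublePoint hΔ, ?_, ?_, ?_, ?_, ?_⟩
    · intro g n hg hgX
      rw [mem_doublePoint_iff hΔ hg, (aeval_veroneseArc_eq_zero_iff hΔ hd hg).mpr hgX]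
      exact dvd_zero _
    · rw [ProjSubscheme.HasLength, Filter.eventually_atTop]
      refine ⟨1, fun n hn => ?_⟩
      rw [ProjSubscheme.hilbertFunction_eq (exists_firstOrder_eq hΔ hd hn)]
      · simp
      · intro g hg
        rw [mem_doublePoint_iff hΔ hg, firstOrder_eq_zero_iff]
    · intro g hg hg1
      rw [mem_doublePoint_iff hΔ hg1, Polynomial.X_pow_dvd_iff] at hg
      have h0 := hg 0 (by norm_num)
      have h1 := hg 1 (by norm_num)
      rw [coeff_aeval_veroneseArc hg1] at h0 h1
      obtain ⟨F, hF⟩ := exists_functional_of_isHomogeneous hg1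
      rw [hF] at h0 h1
      rw [VanishesAt, hF, hf, map_add, map_smul, map_smul, h0, h1, smul_zero, smul_zero, add_zero]
    · intro g hg n hgn
      rw [mem_doublePoint_iff hΔ hgn] at hg
      exact (hvan g n hgn).mpr ((dvd_pow_self _ two_ne_zero).trans hg)
    -- A linear form restricting to `t` gives the nilpotent: its square is zero on the double point,
    -- but it is not.
    · obtain ⟨g, hg, hgX⟩ := exists_linearForm_aeval_eq_X_pow hΔ hd
      rw [pow_one] at hgX
      refine ⟨1, g, hg, ⟨2, 0, 1, isHomogeneous_one _ _, by simp [VanishesAt], ?_⟩, ?_⟩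
      · rw [mem_doublePoint_iff hΔ ((isHomogeneous_one _ _).mul (hg.pow 2)), map_mul, map_pow, hgX]
        exact dvd_mul_left _ _
      · rintro ⟨m, u, hu, hul, hug⟩
        rw [mem_doublePoint_iff hΔ (hu.mul hg), map_mul, hgX, pow_two] at hug
        exact hul ((hvan u m hu).mpr ((mul_dvd_mul_iff_right Polynomial.X_ne_zero).mp hug))

end Tangent

end

noncomputable section

/-! ### Points of the rational normal curve and roots of univariate polynomials -/

section Dictionary

open Polynomial

variable {d : ℕ}

/-- Homogeneous coordinates of a point of the projective line. -/
def lineCoord : Option ℂ → ℂ × ℂ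
  | none => (0, 1)
  | some t => (1, t)

/-- A second vector of `ℂ²`, independent of `lineCoord p`. -/
def lineDir : Option ℂ → ℂ × ℂ
  | none => (1, 0)
  | some _ => (0, 1)

theorem det_lineCoord_lineDir (p : Option ℂ) :
    (lineCoord p).1 * (lineDir p).2 - (lineDir p).1 * (lineCoord p).2 ≠ 0 := by
  cases p <;> simp [lineCoord, lineDir]

theorem veronese_lineCoord_ne_zero (d : ℕ) (p : Option ℂ) :
    veronese d (lineCoord p).1 (lineCoord p).2 ≠ 0 :=
  veronese_ne_zero (by cases p <;> simp [lineCoord])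

/-- The parametrization of the rational normal curve. -/
def curvePoint (d : ℕ) (p : Option ℂ) : PSpace d :=
  Projectivization.mk ℂ _ (veronese_lineCoord_ne_zero d p)

theorem mk_eq_mk_of_smul {v w : Fin (d + 1) → ℂ} (hv : v ≠ 0) (hw : w ≠ 0) {c : ℂ} (h : v = c • w) :
    Projectivization.mk ℂ v hv = Projectivization.mk ℂ w hw :=
  (Projectivization.mk_eq_mk_iff' ℂ v w hv hw).mpr ⟨c, h.symm⟩

theorem curvePoint_injective (hd : 1 ≤ d) : Function.Injective (curvePoint d) := by
  intro p q h
  obtain ⟨c, hc⟩ := (Projectivization.mk_eq_mk_iff' ℂ _ _ _ _).mp h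
  have hc0 := congrFun hc ⟨0, by omega⟩
  have hc1 := congrFun hc ⟨1, by omega⟩
  have hd0 : (d : ℂ) ≠ 0 := Nat.cast_ne_zero.mpr (by omega)
  have hd1 : d ≠ 0 := by omega
  cases p <;> cases q <;> simp_all [veronese, lineCoord]
  exact veronese_lineCoord_ne_zero d none hc.symm

theorem range_curvePoint (hd : 1 ≤ d) : Set.range (curvePoint d) = rationalNormalCurve d := by
  ext p
  constructor
  · rintro ⟨q, rfl⟩
    exact mk_veronese_mem_rationalNormalCurve hd _
  · intro hp
    obtain ⟨a, b, hab⟩ := (mem_rationalNormalCurve_iff hd).mp hp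
    by_cases ha : a = 0
    · refine ⟨none, ?_⟩
      rw [← p.mk_rep, eq_comm]
      refine mk_eq_mk_of_smul _ _ (c := b ^ d) ?_
      rw [hab, ← veronese_mul, ha]
      simp [lineCoord]
    · refine ⟨some (b / a), ?_⟩
      rw [← p.mk_rep, eq_comm]
      refine mk_eq_mk_of_smul _ _ (c := a ^ d) ?_
      rw [hab, ← veronese_mul]
      simp [lineCoord, mul_div_cancel₀ _ ha]

theorem exists_curvePoint_image (hd : 1 ≤ d) {B : Finset (PSpace d)}
    (hB : (B : Set (PSpace d)) ⊆ rationalNormalCurve d) :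
    ∃ A : Finset (Option ℂ), A.map ⟨_, curvePoint_injective hd⟩ = B := by
  classical
  rw [← range_curvePoint hd, ← Set.image_univ, Finset.subset_set_image_iff] at hB
  obtain ⟨A, -, hA⟩ := hB
  exact ⟨A, by rw [← hA, Finset.map_eq_image]; rfl⟩

/-- The functional on univariate polynomials (seen as forms of degree `d`) given by apolarity with
the form with coefficient vector `c`. -/
def apolarFunctional (d : ℕ) (c : Fin (d + 1) → ℂ) : ℂ[X] →ₗ[ℂ] ℂ :=
  ∑ i : Fin (d + 1), (c i / d.choose i) • lcoeff ℂ i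

theorem apolarFunctional_apply (c : Fin (d + 1) → ℂ) (h : ℂ[X]) :
    apolarFunctional d c h = ∑ i : Fin (d + 1), c i / d.choose i * h.coeff i := by
  simp [apolarFunctional]

theorem choose_cast_ne_zero (i : Fin (d + 1)) : (d.choose i : ℂ) ≠ 0 :=
  Nat.cast_ne_zero.mpr (Nat.choose_pos (by omega)).ne'

/-- The functional on coefficient vectors given by apolarity with `h`. -/
def apolarDual (d : ℕ) (h : ℂ[X]) : (Fin (d + 1) → ℂ) →ₗ[ℂ] ℂ where
  toFun c := apolarFunctional d c h
  map_add' c c' := by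
    simp only [apolarFunctional_apply, Pi.add_apply, ← Finset.sum_add_distrib]
    exact Finset.sum_congr rfl fun i _ => by ring
  map_smul' r c := by
    simp only [apolarFunctional_apply, Pi.smul_apply, smul_eq_mul, Finset.mul_sum,
      RingHom.id_apply]
    exact Finset.sum_congr rfl fun i _ => by ring

theorem apolarDual_apply (c : Fin (d + 1) → ℂ) (h : ℂ[X]) :
    apolarDual d h c = apolarFunctional d c h := rfl

theorem exists_apolarDual_eq (F : (Fin (d + 1) → ℂ) →ₗ[ℂ] ℂ) :
    ∃ h : ℂ[X], h.natDegree ≤ d ∧ apolarDual d h = F := by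
  refine ⟨∑ i : Fin (d + 1), C (F (Pi.single i 1) * d.choose i) * X ^ (i : ℕ), ?_, ?_⟩
  · refine natDegree_sum_le_of_forall_le _ _ fun i _ => ?_
    exact (natDegree_C_mul_X_pow_le _ _).trans (by omega)
  · refine LinearMap.pi_ext' fun i => LinearMap.ext_ring ?_
    rw [LinearMap.comp_apply, LinearMap.comp_apply, apolarDual_apply, apolarFunctional_apply,
      Finset.sum_eq_single i]
    · simp only [finsetSum_coeff, coeff_C_mul, coeff_X_pow]
      rw [Finset.sum_eq_single i]
      · have := choose_cast_ne_zero i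
        simp
        field_simp
      · intro j _ hj
        rw [if_neg (fun h => hj (Fin.ext h.symm)), mul_zero]
      · simp
    · intro j _ hj
      simp [hj]
    · simp

theorem exists_apolarFunctional_ne_zero {c : Fin (d + 1) → ℂ} (hc : c ≠ 0) :
    ∃ h : ℂ[X], h.natDegree ≤ d ∧ apolarFunctional d c h ≠ 0 := by
  obtain ⟨i, hi⟩ := Function.ne_iff.mp hc
  obtain ⟨h, hd, hh⟩ := exists_apolarDual_eq (LinearMap.proj i : (Fin (d + 1) → ℂ) →ₗ[ℂ] ℂ)
  refine ⟨h, hd, ?_⟩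
  rw [← apolarDual_apply, hh]
  exact hi

theorem apolarFunctional_veronese_some (t : ℂ) {h : ℂ[X]} (hd : h.natDegree ≤ d) :
    apolarFunctional d (veronese d 1 t) h = h.eval t := by
  rw [apolarFunctional_apply, eval_eq_sum_range' (Nat.lt_succ_of_le hd), Finset.sum_range]
  refine Finset.sum_congr rfl fun i _ => ?_
  have := choose_cast_ne_zero i
  simp only [veronese, one_pow]
  field_simp

theorem apolarFunctional_single (j : Fin (d + 1)) (c : ℂ) (h : ℂ[X]) :
    apolarFunctional d (Pi.single j c) h = c / d.choose j * h.coeff j := by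
  rw [apolarFunctional_apply, Finset.sum_eq_single j]
  · simp
  · intro i _ hi; simp [hi]
  · simp

theorem veroneseCoeff_none {k : ℕ} (hk : k ≤ d) :
    veroneseCoeff d 0 1 1 0 k =
      Pi.single ⟨d - k, by omega⟩ (d.choose (d - k) : ℂ) := by
  ext i
  rw [veroneseCoeff, veroneseArc, veronese]
  simp only [C_0, C_1, zero_mul, one_mul, zero_add, add_zero, one_pow, mul_one]
  rw [← C_eq_natCast, coeff_C_mul, coeff_X_pow, Pi.single_apply]
  by_cases h : k = d - (i : ℕ)
  · have hi : i = ⟨d - k, by omega⟩ := Fin.ext (by simp only; omega)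
    rw [if_pos h, if_pos hi, hi, mul_one]
  · have hi : i ≠ ⟨d - k, by omega⟩ := fun hi => h (by
      have := congrArg Fin.val hi
      simp only at this
      omega)
    rw [if_neg h, if_neg hi, mul_zero]

theorem veroneseCoeff_one (a b a' b' : ℂ) (i : Fin (d + 1)) :
    veroneseCoeff d a b a' b' 1 i = d.choose i *
      ((d - (i : ℕ) : ℕ) * a ^ (d - (i : ℕ) - 1) * a' * b ^ (i : ℕ) +
        a ^ (d - (i : ℕ)) * ((i : ℕ) * b ^ ((i : ℕ) - 1) * b')) := by
  have h : ∀ p : ℂ[X], p.coeff 1 = (derivative p).eval 0 := fun p => by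
    rw [← coeff_zero_eq_eval_zero, coeff_derivative]; simp
  rw [veroneseCoeff, h, veroneseArc, veronese, mul_assoc, ← C_eq_natCast, derivative_C_mul,
    derivative_mul, derivative_pow, derivative_pow]
  simp

theorem apolarFunctional_veroneseCoeff_zero (p : Option ℂ) {h : ℂ[X]} (hd : h.natDegree ≤ d) :
    apolarFunctional d (veronese d (lineCoord p).1 (lineCoord p).2) h = 0 ↔
      (match p with | none => h.coeff d = 0 | some t => h.IsRoot t) := by
  cases p with
  | none =>
    have h1 := veroneseCoeff_none (d := d) (Nat.zero_le d)
    rw [veroneseCoeff_zero] at h1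
    rw [lineCoord, h1, apolarFunctional_single]
    simp
  | some t =>
    rw [lineCoord, apolarFunctional_veronese_some t hd]
    rfl

/-- Linear functionals on `ℂ ^ (d + 1)` are polynomials `h` of degree at most `d`, and those
vanishing at the points of `A` are the multiples of `rootForm A`, with a degree drop when `none ∈
A`. -/
theorem isApolar_rootForm_iff {c : Fin (d + 1) → ℂ} {A : Finset (Option ℂ)} :
    IsApolar (apolarFunctional d c) d A.card (rootForm A) ↔
      ∀ F : (Fin (d + 1) → ℂ) →ₗ[ℂ] ℂ,
        (∀ p ∈ A, F (veronese d (lineCoord p).1 (lineCoord p).2) = 0) → F c = 0 := by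
  classical
  constructor
  · intro hA F hF
    obtain ⟨h, hhd, rfl⟩ := exists_apolarDual_eq F
    rw [apolarDual_apply]
    rcases eq_or_ne h 0 with rfl | h0
    · rw [map_zero]
    have hroot : ∀ t ∈ A.eraseNone, h.IsRoot t := fun t ht =>
      (apolarFunctional_veroneseCoeff_zero (some t) hhd).mp (hF _ (Finset.mem_eraseNone.mp ht))
    have hdvd : rootForm A ∣ h := by
      refine Finset.prod_dvd_of_coprime (fun s _ t _ hst => ?_) fun t ht =>
        dvd_iff_isRoot.mpr (hroot t ht)
      exact pairwise_coprime_X_sub_C Function.injective_id hst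
    obtain ⟨u, rfl⟩ := hdvd
    have hu0 : u ≠ 0 := right_ne_zero_of_mul h0
    have hdeg := natDegree_mul (rootForm_monic A).ne_zero hu0
    rw [natDegree_rootForm] at hdeg
    refine hA u ?_
    by_cases hn : none ∈ A
    · have h1 := (apolarFunctional_veroneseCoeff_zero none hhd).mp (hF _ hn)
      have h2 : (rootForm A * u).natDegree ≠ d := fun h2 => h0 (by
        rw [← leadingCoeff_eq_zero, leadingCoeff, h2]; exact h1)
      have := card_eraseNone_of_mem hn
      omega
    · have := card_eraseNone_of_notMem hn
      omega
  · intro h u hu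
    have hdeg := natDegree_mul_le (p := rootForm A) (q := u)
    have hle := natDegree_rootForm_le A
    refine h (apolarDual d (rootForm A * u)) fun p hp => ?_
    rw [apolarDual_apply, apolarFunctional_veroneseCoeff_zero p (by omega)]
    have hp' := isFormRoot_rootForm.mpr hp
    cases p with
    | none =>
      simp only [IsFormRoot] at hp'
      exact coeff_eq_zero_of_natDegree_lt (by omega)
    | some t => exact root_mul_right_of_isRoot u hp'

theorem functional_rep_mk_eq_zero_iff (F : (Fin (d + 1) → ℂ) →ₗ[ℂ] ℂ) {v : Fin (d + 1) → ℂ}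
    (hv : v ≠ 0) : F (Projectivization.mk ℂ v hv).rep = 0 ↔ F v = 0 := by
  obtain ⟨u, hu⟩ := Projectivization.exists_smul_eq_mk_rep ℂ v hv
  rw [← hu, Units.smul_def, map_smul, smul_eq_mul, mul_eq_zero]
  exact or_iff_right u.ne_zero

theorem submodule_le_iSup_curvePoint_iff (hd : 1 ≤ d) {f : PSpace d} {A : Finset (Option ℂ)} :
    f.submodule ≤ ⨆ q ∈ A.map ⟨_, curvePoint_injective hd⟩, q.submodule ↔
      IsApolar (apolarFunctional d f.rep) d A.card (rootForm A) := by
  rw [submodule_le_iSup_iff, isApolar_rootForm_iff]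
  refine forall_congr' fun F => imp_congr ?_ Iff.rfl
  simp only [Finset.mem_map, Function.Embedding.coeFn_mk, forall_exists_index, and_imp,
    forall_apply_eq_imp_iff₂]
  exact forall₂_congr fun p _ => functional_rep_mk_eq_zero_iff F _

theorem apolarFunctional_veroneseCoeff_one_none (hd : 1 ≤ d) (h : ℂ[X]) :
    apolarFunctional d (veroneseCoeff d 0 1 1 0 1) h = h.coeff (d - 1) := by
  rw [veroneseCoeff_none hd, apolarFunctional_single, div_self, one_mul]
  exact choose_cast_ne_zero ⟨d - 1, by omega⟩

theorem apolarFunctional_veroneseCoeff_one_some (t : ℂ) {h : ℂ[X]} (hd : h.natDegree ≤ d) :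
    apolarFunctional d (veroneseCoeff d 1 t 0 1 1) h = (derivative h).eval t := by
  rw [derivative_eval, sum_over_range' _ (by simp) (d + 1) (Nat.lt_succ_of_le hd),
    apolarFunctional_apply, Finset.sum_range]
  refine Finset.sum_congr rfl fun i _ => ?_
  have := choose_cast_ne_zero i
  rw [veroneseCoeff_one]
  simp
  field_simp

/-- The square of a linear form is apolar exactly to the points of a tangent line. -/
theorem isApolar_squareForm_iff (hd : 2 ≤ d) {c : Fin (d + 1) → ℂ} {p : Option ℂ} :
    IsApolar (apolarFunctional d c) d 2 (squareForm p) ↔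
      ∃ x y : ℂ, c = x • veroneseCoeff d (lineCoord p).1 (lineCoord p).2 (lineDir p).1
        (lineDir p).2 0 + y • veroneseCoeff d (lineCoord p).1 (lineCoord p).2 (lineDir p).1
        (lineDir p).2 1 := by
  constructor
  · intro hp
    have hspan : c ∈ Submodule.span ℂ {veroneseCoeff d (lineCoord p).1 (lineCoord p).2
        (lineDir p).1 (lineDir p).2 0, veroneseCoeff d (lineCoord p).1 (lineCoord p).2
        (lineDir p).1 (lineDir p).2 1} := by
      by_contra hn
      obtain ⟨F, hF, hker⟩ := Submodule.exists_le_ker_of_notMem hn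
      apply hF
      obtain ⟨h, hhd, rfl⟩ := exists_apolarDual_eq F
      have h0 := hker (Submodule.subset_span (Set.mem_insert _ _))
      have h1 := hker (Submodule.subset_span (Set.mem_insert_of_mem _ (Set.mem_singleton _)))
      rw [LinearMap.mem_ker, apolarDual_apply] at h0 h1
      rw [veroneseCoeff_zero, apolarFunctional_veroneseCoeff_zero p hhd] at h0
      rw [apolarDual_apply]
      rcases eq_or_ne h 0 with rfl | hne
      · rw [map_zero]
      cases p with
      | none =>
        simp only [lineCoord, lineDir] at h0 h1
        rw [apolarFunctional_veroneseCoeff_one_none (by omega)] at h1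
        have h2 : h.natDegree ≠ d := fun h2 => hne (by
          rw [← leadingCoeff_eq_zero, leadingCoeff, h2]; exact h0)
        have h3 : h.natDegree ≠ d - 1 := fun h2 => hne (by
          rw [← leadingCoeff_eq_zero, leadingCoeff, h2]; exact h1)
        rw [← one_mul h]
        exact hp h (by omega)
      -- Vanishing on the point and on the tangent direction means `h` and its derivative vanish at
      -- `t`, so `h` is a multiple of the square.
      | some t =>
        simp only [lineCoord, lineDir] at h0 h1
        rw [apolarFunctional_veroneseCoeff_one_some t hhd] at h1
        obtain ⟨u, rfl⟩ := sq_dvd_of_isRoot_derivative h0 h1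
        refine hp u ?_
        rwa [natDegree_mul (pow_ne_zero _ (X_sub_C_ne_zero t)) (right_ne_zero_of_mul hne),
          natDegree_pow, natDegree_X_sub_C, mul_one, add_comm] at hhd
    obtain ⟨x, y, hxy⟩ := Submodule.mem_span_pair.mp hspan
    exact ⟨x, y, hxy.symm⟩
  · rintro ⟨x, y, rfl⟩ u hu
    have hsq : (squareForm p * u).natDegree ≤ d := by
      have h1 := natDegree_mul_le (p := squareForm p) (q := u)
      have h2 : (squareForm p).natDegree ≤ 2 := by
        cases p with
        | none => simp [squareForm]
        | some t => simp [squareForm, natDegree_pow]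
      omega
    rw [← apolarDual_apply, map_add, map_smul, map_smul, apolarDual_apply, apolarDual_apply,
      veroneseCoeff_zero]
    have h0 := (apolarFunctional_veroneseCoeff_zero p hsq).mpr
    have h1 : apolarFunctional d (veroneseCoeff d (lineCoord p).1 (lineCoord p).2 (lineDir p).1
        (lineDir p).2 1) (squareForm p * u) = 0 := by
      cases p with
      | none =>
        rw [lineCoord, lineDir, apolarFunctional_veroneseCoeff_one_none (by omega), squareForm,
          one_mul]
        exact coeff_eq_zero_of_natDegree_lt (by omega)
      | some t =>
        rw [lineCoord, lineDir, apolarFunctional_veroneseCoeff_one_some t hsq]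
        exact (isRoot_derivative_of_sq_dvd (dvd_mul_right _ _)).2
    rw [h1, h0, smul_zero, smul_zero, add_zero]
    cases p with
    | none =>
      simp only [squareForm, one_mul]
      exact coeff_eq_zero_of_natDegree_lt (by omega)
    | some t => exact (isRoot_derivative_of_sq_dvd (dvd_mul_right _ _)).1

end Dictionary

end

noncomputable section

/-! ### Decompositions of points of tangent lines -/

theorem sum_range_pow_of_isPrimitiveRoot {ζ : ℂ} {m : ℕ} (hζ : IsPrimitiveRoot ζ m) (e : ℕ) :
    ∑ j ∈ Finset.range m, (ζ ^ j) ^ e = if m ∣ e then (m : ℂ) else 0 := by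
  simp_rw [← pow_mul, mul_comm _ e, pow_mul]
  split_ifs with h
  · simp [(hζ.pow_eq_one_iff_dvd e).mpr h]
  · have h1 : ζ ^ e ≠ 1 := fun h1 => h ((hζ.pow_eq_one_iff_dvd e).mp h1)
    rw [geom_sum_eq h1, ← pow_mul, mul_comm, pow_mul, hζ.pow_eq_one, one_pow, sub_self, zero_div]

section Tangent

variable {d : ℕ} {a b a' b' : ℂ}

/-- Averaging over the `m`-th roots of unity filters the expansion of `(L + t M) ^ d`, keeping the
exponents `k` with `k ≡ -e` modulo `m`. -/
theorem sum_veronese_of_isPrimitiveRoot {ζ : ℂ} {m : ℕ} (hζ : IsPrimitiveRoot ζ m) (s : ℂ) (e : ℕ) :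
    ∑ j ∈ Finset.range m, (ζ ^ j) ^ e • veronese d (a + s * ζ ^ j * a') (b + s * ζ ^ j * b') =
      ∑ k ∈ Finset.range (d + 1), (if m ∣ e + k then (m : ℂ) else 0) •
        s ^ k • veroneseCoeff d a b a' b' k := by
  simp_rw [veronese_eq_sum_veroneseCoeff, Finset.smul_sum]
  rw [Finset.sum_comm]
  refine Finset.sum_congr rfl fun k _ => ?_
  rw [← sum_range_pow_of_isPrimitiveRoot hζ, Finset.sum_smul]
  refine Finset.sum_congr rfl fun j _ => ?_
  rw [smul_smul, smul_smul]
  congr 1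
  rw [mul_pow, pow_add]
  ring

/-- With `m = d` and `e = d - 1`, only `k = 1` survives among `0, …, d`. -/
theorem smul_veroneseCoeff_one (hd : 2 ≤ d) {ζ : ℂ} (hζ : IsPrimitiveRoot ζ d) (s : ℂ) :
    (d * s) • veroneseCoeff d a b a' b' 1 =
      ∑ j ∈ Finset.range d,
        (ζ ^ j) ^ (d - 1) • veronese d (a + s * ζ ^ j * a') (b + s * ζ ^ j * b') := by
  rw [sum_veronese_of_isPrimitiveRoot hζ, Finset.sum_eq_single 1]
  · rw [Nat.sub_add_cancel (by omega), if_pos dvd_rfl, pow_one, smul_smul]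
  · intro k hk hk1
    rw [Finset.mem_range] at hk
    rw [if_neg, zero_smul]
    rintro ⟨q, hq⟩
    rcases q with _ | _ | q
    · omega
    · omega
    · have : d * 2 ≤ d * (q + 1 + 1) := Nat.mul_le_mul_left _ (by omega)
      omega
  · intro h
    rw [Finset.mem_range] at h
    omega

theorem veroneseCoeff_last : veroneseCoeff d a b a' b' d = veronese d a' b' := by
  have h : ∀ (x x' : ℂ) (m : ℕ), ((Polynomial.C x + Polynomial.C x' * Polynomial.X) ^ m).coeff m =
      x' ^ m := by
    intro x x' m
    have h1 : (Polynomial.C x + Polynomial.C x' * Polynomial.X).natDegree ≤ 1 := by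
      rw [add_comm]; exact Polynomial.natDegree_linear_le
    have := Polynomial.coeff_pow_of_natDegree_le (m := m) h1
    rw [mul_one] at this
    rw [this]
    simp
  have hn : ∀ (x x' : ℂ) (m : ℕ),
      ((Polynomial.C x + Polynomial.C x' * Polynomial.X) ^ m).natDegree ≤ m := by
    intro x x' m
    have h1 : (Polynomial.C x + Polynomial.C x' * Polynomial.X).natDegree ≤ 1 := by
      rw [add_comm]; exact Polynomial.natDegree_linear_le
    exact (Polynomial.natDegree_pow_le_of_le m h1).trans (by omega)
  ext i
  rw [veroneseCoeff, veroneseArc, veronese, veronese, mul_assoc, mul_assoc,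
    ← Polynomial.C_eq_natCast, Polynomial.coeff_C_mul]
  have := Polynomial.coeff_mul_add_eq_of_natDegree_le (hn a a' (d - (i : ℕ))) (hn b b' i)
  rw [Nat.sub_add_cancel (by omega), h, h] at this
  rw [this]

/-- With `m = d - 1` and `e = d - 2`, exactly `k = 1` and `k = d` survive; for `d = 2` the exponent
`0` would survive too. Moving `M ^ d` across gives a decomposition that uses the point `M` itself.
-/
theorem smul_veroneseCoeff_one_add (hd : 3 ≤ d) {ζ : ℂ} (hζ : IsPrimitiveRoot ζ (d - 1)) :
    ((d - 1 : ℕ) : ℂ) • (veroneseCoeff d a b a' b' 1 + veronese d a' b') =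
      ∑ j ∈ Finset.range (d - 1),
        (ζ ^ j) ^ (d - 2) • veronese d (a + 1 * ζ ^ j * a') (b + 1 * ζ ^ j * b') := by
  rw [sum_veronese_of_isPrimitiveRoot hζ, Finset.sum_range_succ,
    if_pos ⟨2, by omega⟩, Finset.sum_eq_single 1, if_pos ⟨1, by omega⟩]
  · simp only [one_pow, one_smul]
    rw [← smul_add, veroneseCoeff_last]
  · intro k hk hk1
    rw [Finset.mem_range] at hk
    rw [if_neg, zero_smul]
    rintro ⟨q, hq⟩
    rcases q with _ | _ | q
    · omega
    · omega
    · have : (d - 1) * 2 ≤ (d - 1) * (q + 1 + 1) := Nat.mul_le_mul_left _ (by omega)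
      omega
  · intro h
    rw [Finset.mem_range] at h
    omega

theorem veroneseCoeff_one_add (hd : 1 ≤ d) (c : ℂ) :
    veroneseCoeff d a b (a' + c * a) (b' + c * b) 1 =
      veroneseCoeff d a b a' b' 1 + (c * d) • veronese d a b := by
  ext i
  rw [Pi.add_apply, Pi.smul_apply, veroneseCoeff_one, veroneseCoeff_one, veronese, smul_eq_mul]
  obtain ⟨m, hm⟩ : ∃ m, d = i + m := ⟨d - i, by omega⟩
  generalize (i : ℕ) = n at hm
  subst hm
  rw [Nat.add_sub_cancel_left]
  rcases m with _ | m <;> rcases n with _ | n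
  · omega
  · simp; ring
  · simp; ring
  · push_cast
    ring

/-- Both sides are `2 L M`: a plane conic has two tangent lines through the point, which makes `d =
2` exceptional. -/
theorem veroneseCoeff_one_swap : veroneseCoeff 2 a b a' b' 1 = veroneseCoeff 2 a' b' a b 1 := by
  ext i
  rw [veroneseCoeff_one, veroneseCoeff_one]
  fin_cases i <;> simp <;> ring

/-- A point `[L ^ (d - 1) M]` is in the span of at most `d` points of the rational normal curve,
one of which may be any point different from `[L ^ d]`, and from `[M ^ d]` if `d = 2`. -/
theorem exists_finset_of_tangent (hd : 2 ≤ d) (hΔ : a * b' - a' * b ≠ 0) {f : PSpace d} {y : ℂ}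
    (hf : f.rep = y • veroneseCoeff d a b a' b' 1) {u v : ℂ} (hv : v ≠ 0) (huv : d = 2 → u ≠ 0)
    (hne : veronese d (u * a + v * a') (u * b + v * b') ≠ 0) :
    ∃ B : Finset (PSpace d), (B : Set (PSpace d)) ⊆ rationalNormalCurve d ∧ B.card ≤ d ∧
      f.submodule ≤ (⨆ q ∈ B, q.submodule) ∧ Projectivization.mk ℂ _ hne ∈ B := by
  classical
  have hne' : ∀ t : ℂ, veronese d (a + t * a') (b + t * b') ≠ 0 := by
    refine fun t => veronese_ne_zero ?_
    by_contra! h0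
    apply hΔ
    linear_combination b' * h0.1 - a' * h0.2
  -- If `u = 0`, the prescribed point is `M`, used together with `d - 1` further points. If `u ≠ 0`,
  -- the scale `s = v / u` puts the prescribed point at `j = 0`.
  by_cases hu : u = 0
  · have hd3 : 3 ≤ d := by
      rcases hd.lt_or_eq with h | h
      · exact h
      · exact absurd hu (huv h.symm)
    set ζ := Complex.exp (2 * Real.pi * Complex.I / ((d - 1 : ℕ) : ℂ)) with hζ'
    have hζ : IsPrimitiveRoot ζ (d - 1) := Complex.isPrimitiveRoot_exp _ (by omega)
    refine ⟨insert (Projectivization.mk ℂ _ hne) ((Finset.range (d - 1)).image fun j =>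
      Projectivization.mk ℂ _ (hne' (1 * ζ ^ j))), ?_, ?_, ?_, Finset.mem_insert_self _ _⟩
    · intro q hq
      rw [Finset.coe_insert, Set.mem_insert_iff, Finset.mem_coe, Finset.mem_image] at hq
      rcases hq with rfl | ⟨j, -, rfl⟩
      · exact mk_veronese_mem_rationalNormalCurve (by omega) _
      · exact mk_veronese_mem_rationalNormalCurve (by omega) _
    · have h1 := Finset.card_insert_le (Projectivization.mk ℂ _ hne)
        ((Finset.range (d - 1)).image fun j => Projectivization.mk ℂ _ (hne' (1 * ζ ^ j)))
      have h2 := Finset.card_image_le (s := Finset.range (d - 1))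
        (f := fun j => Projectivization.mk ℂ _ (hne' (1 * ζ ^ j)))
      rw [Finset.card_range] at h2
      omega
    · rw [submodule_le_iSup_iff]
      intro F hF
      have h1 : F (veronese d a' b') = 0 := by
        have := hF _ (Finset.mem_insert_self _ _)
        rw [functional_rep_mk_eq_zero_iff, hu, zero_mul, zero_mul, zero_add, zero_add,
          veronese_mul, map_smul, smul_eq_zero] at this
        exact this.resolve_left (pow_ne_zero _ hv)
      have h2 := congrArg F (smul_veroneseCoeff_one_add (a := a) (b := b) (a' := a') (b' := b')
        hd3 hζ)
      rw [map_sum, Finset.sum_eq_zero, map_smul, map_add, h1, add_zero, smul_eq_zero] at h2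
      · rw [hf, map_smul, h2.resolve_left (Nat.cast_ne_zero.mpr (by omega)), smul_zero]
      · intro j hj
        rw [map_smul, (functional_rep_mk_eq_zero_iff F (hne' _)).mp
          (hF _ (Finset.mem_insert_of_mem (Finset.mem_image_of_mem _ hj))), smul_zero]
  · set ζ := Complex.exp (2 * Real.pi * Complex.I / (d : ℂ)) with hζ'
    have hζ : IsPrimitiveRoot ζ d := Complex.isPrimitiveRoot_exp _ (by omega)
    refine ⟨(Finset.range d).image fun j =>
      Projectivization.mk ℂ _ (hne' (v / u * ζ ^ j)), ?_, ?_, ?_, ?_⟩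
    · intro q hq
      rw [Finset.mem_coe, Finset.mem_image] at hq
      obtain ⟨j, -, rfl⟩ := hq
      exact mk_veronese_mem_rationalNormalCurve (by omega) _
    · exact Finset.card_image_le.trans (Finset.card_range d).le
    · rw [submodule_le_iSup_iff]
      intro F hF
      have h2 := congrArg F (smul_veroneseCoeff_one (a := a) (b := b) (a' := a') (b' := b')
        hd hζ (v / u))
      rw [map_sum, Finset.sum_eq_zero, map_smul, smul_eq_zero] at h2
      · rw [hf, map_smul, h2.resolve_left (mul_ne_zero (Nat.cast_ne_zero.mpr (by omega))
          (div_ne_zero hv hu)), smul_zero]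
      · intro j hj
        rw [map_smul, (functional_rep_mk_eq_zero_iff F (hne' _)).mp
          (hF _ (Finset.mem_image_of_mem _ hj)), smul_zero]
    · rw [Finset.mem_image]
      refine ⟨0, Finset.mem_range.mpr (by omega), ?_⟩
      refine (mk_eq_mk_of_smul _ _ (c := u ^ d) ?_).symm
      rw [← veronese_mul]
      congr 1 <;> field_simp

/-- A point of a tangent line of the rational normal curve, other than the point of contact, is
`[L ^ (d - 1) M]` with independent `L` and `M`. -/
theorem exists_eq_smul_veroneseCoeff_one (hd : 1 ≤ d) (hΔ : a * b' - a' * b ≠ 0)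
    {c : Fin (d + 1) → ℂ} {x y : ℂ} (hy : y ≠ 0)
    (hc : c = x • veroneseCoeff d a b a' b' 0 + y • veroneseCoeff d a b a' b' 1) :
    ∃ a'' b'' : ℂ, a * b'' - a'' * b ≠ 0 ∧ c = y • veroneseCoeff d a b a'' b'' 1 := by
  have hd0 : (d : ℂ) ≠ 0 := Nat.cast_ne_zero.mpr (by omega)
  -- The term `x L ^ d` is absorbed by adding a multiple of `L` to `M`; the factor `d` comes from `d
  -- L ^ (d - 1) M`.
  refine ⟨a' + x / (y * d) * a, b' + x / (y * d) * b, fun h => hΔ (by linear_combination h), ?_⟩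
  have h : y * (x / (y * d) * d) = x := by field_simp
  rw [veroneseCoeff_one_add hd, hc, veroneseCoeff_zero, smul_add, smul_smul, h,
    add_comm (x • veronese d a b)]

end Tangent

/-! ### The main theorem -/

section Main

variable {d : ℕ} {f : PSpace d}

theorem xRank_le_of_isApolar (hd : 1 ≤ d) {A : Finset (Option ℂ)}
    (hA : IsApolar (apolarFunctional d f.rep) d A.card (rootForm A)) :
    xRank (rationalNormalCurve d) f ≤ A.card := by
  refine Nat.sInf_le ⟨A.map ⟨_, curvePoint_injective hd⟩, ?_, Finset.card_map _,
    (submodule_le_iSup_curvePoint_iff hd).mpr hA⟩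
  rw [← range_curvePoint hd, Finset.coe_map]
  exact Set.image_subset_range _ _

theorem exists_isApolar_card_eq_xRank (hd : 1 ≤ d) (f : PSpace d) : ∃ A : Finset (Option ℂ),
    A.card = xRank (rationalNormalCurve d) f ∧
      IsApolar (apolarFunctional d f.rep) d A.card (rootForm A) := by
  have hne : {s | ∃ A : Finset (PSpace d), (A : Set (PSpace d)) ⊆ rationalNormalCurve d ∧
      A.card = s ∧ f.submodule ≤ ⨆ q ∈ A, q.submodule}.Nonempty := by
    -- Any `d + 1` points of the curve span the whole space, so the infimum defining the rank is
    -- attained.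
    obtain ⟨A, hA⟩ := Infinite.exists_subset_card_eq (Option ℂ) (d + 1)
    refine ⟨_, A.map ⟨_, curvePoint_injective hd⟩, ?_, rfl,
      (submodule_le_iSup_curvePoint_iff hd).mpr fun u hu => by omega⟩
    rw [← range_curvePoint hd, Finset.coe_map]
    exact Set.image_subset_range _ _
  obtain ⟨B, hBX, hB, hfB⟩ := Nat.sInf_mem hne
  obtain ⟨A, rfl⟩ := exists_curvePoint_image hd hBX
  exact ⟨A, (Finset.card_map _).symm.trans hB,
    (submodule_le_iSup_curvePoint_iff hd).mp hfB⟩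

theorem curvePoint_mem_forbiddenLocus_iff (hd : 1 ≤ d) {p : Option ℂ} :
    curvePoint d p ∈ forbiddenLocus (rationalNormalCurve d) f ↔
      ∀ A : Finset (Option ℂ), A.card = xRank (rationalNormalCurve d) f →
        IsApolar (apolarFunctional d f.rep) d A.card (rootForm A) → p ∉ A := by
  rw [mem_forbiddenLocus_iff fun _ => mem_rationalNormalCurve_of_forall_vanishesAt hd]
  constructor
  · rintro ⟨-, h⟩ A hA hA' hp
    refine h (A.map ⟨_, curvePoint_injective hd⟩) ?_ ((Finset.card_map _).trans hA)
      ((submodule_le_iSup_curvePoint_iff hd).mpr hA')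
      (Finset.mem_map.mpr ⟨p, hp, rfl⟩)
    rw [← range_curvePoint hd, Finset.coe_map]
    exact Set.image_subset_range _ _
  · intro h
    refine ⟨range_curvePoint hd ▸ Set.mem_range_self p, fun B hBX hB hfB hp => ?_⟩
    obtain ⟨A, rfl⟩ := exists_curvePoint_image hd hBX
    rw [Finset.card_map] at hB
    refine h A hB ((submodule_le_iSup_curvePoint_iff hd).mp hfB) ?_
    obtain ⟨q, hq, hqp⟩ := Finset.mem_map.mp hp
    rwa [← curvePoint_injective hd hqp]

theorem curvePoint_mem_ranestadSchreyerLocus_iff (hd : 2 ≤ d) {p : Option ℂ} :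
    curvePoint d p ∈ ranestadSchreyerLocus (rationalNormalCurve d) f 2 ↔
      IsApolar (apolarFunctional d f.rep) d 2 (squareForm p) := by
  rw [isApolar_squareForm_iff hd]
  exact mem_ranestadSchreyerLocus_iff (det_lineCoord_lineDir p) (by omega) _

theorem forbiddenLocus_nonempty (hd : 1 ≤ d) (f : PSpace d) :
    (forbiddenLocus (rationalNormalCurve d) f).Nonempty := by
  obtain ⟨A₀, hA₀, hA₀'⟩ := exists_isApolar_card_eq_xRank hd f
  obtain ⟨p, hp⟩ := exists_notMem_of_isApolar_rootForm hd
    (exists_apolarFunctional_ne_zero f.rep_nonzero) (fun A hA => xRank_le_of_isApolar hd hA) hA₀ hA₀'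
  exact ⟨_, (curvePoint_mem_forbiddenLocus_iff hd).mpr hp⟩

theorem eq_curvePoint_of_isApolar (hd : 1 ≤ d) {p : Option ℂ}
    (h : IsApolar (apolarFunctional d f.rep) d 1 (rootForm {p})) : f = curvePoint d p := by
  have h1 : f.submodule ≤ ⨆ q ∈ ({p} : Finset (Option ℂ)).map ⟨_, curvePoint_injective hd⟩,
      q.submodule := (submodule_le_iSup_curvePoint_iff hd).mpr h
  rw [Finset.map_singleton] at h1
  simp only [Finset.mem_singleton, iSup_iSup_eq_left, Function.Embedding.coeFn_mk] at h1
  refine Projectivization.submodule_injective (Submodule.eq_of_le_of_finrank_le h1 ?_)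
  rw [Projectivization.finrank_submodule, Projectivization.finrank_submodule]

theorem isApolar_rootForm_mono {c : Fin (d + 1) → ℂ} {A B : Finset (Option ℂ)}
    (hAB : A ⊆ B) (hA : IsApolar (apolarFunctional d c) d A.card (rootForm A)) :
    IsApolar (apolarFunctional d c) d B.card (rootForm B) := by
  rw [isApolar_rootForm_iff] at hA ⊢
  exact fun F hF => hA F fun p hp => hF p (hAB hp)

theorem isApolar_rootForm_singleton_of_eq_smul {c : Fin (d + 1) → ℂ} {p : Option ℂ}
    {x : ℂ} (hc : c = x • veronese d (lineCoord p).1 (lineCoord p).2) :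
    IsApolar (apolarFunctional d c) d 1 (rootForm {p}) := by
  have := (isApolar_rootForm_iff (c := c) (A := {p})).mpr fun F hF => by
    rw [hc, map_smul, hF p (Finset.mem_singleton_self p), smul_zero]
  rwa [Finset.card_singleton] at this

theorem exists_tangent_of_notMem (hd : 2 ≤ d) {p : Option ℂ}
    (hp : IsApolar (apolarFunctional d f.rep) d 2 (squareForm p))
    (hf : ¬ IsApolar (apolarFunctional d f.rep) d 1 (rootForm {p})) :
    ∃ y a' b' : ℂ, y ≠ 0 ∧ (lineCoord p).1 * b' - a' * (lineCoord p).2 ≠ 0 ∧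
      f.rep = y • veroneseCoeff d (lineCoord p).1 (lineCoord p).2 a' b' 1 := by
  obtain ⟨x, y, hxy⟩ := (isApolar_squareForm_iff hd).mp hp
  have hy : y ≠ 0 := by
    rintro rfl
    refine hf (isApolar_rootForm_singleton_of_eq_smul (x := x) ?_)
    rw [hxy, zero_smul, add_zero, veroneseCoeff_zero]
  obtain ⟨a', b', hΔ, h⟩ := exists_eq_smul_veroneseCoeff_one (by omega) (det_lineCoord_lineDir p)
    hy hxy
  exact ⟨y, a', b', hy, hΔ, h⟩

/-- A tangency point lying in a decomposition of length `d` would make `f` a `d`-th power, of rank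
at most `1 < d`. -/
theorem ranestadSchreyerLocus_subset_forbiddenLocus (hd : 2 ≤ d)
    (hr : xRank (rationalNormalCurve d) f = d) :
    ranestadSchreyerLocus (rationalNormalCurve d) f 2 ⊆
      forbiddenLocus (rationalNormalCurve d) f := by
  intro l hl
  have hlX := hl.1
  rw [← range_curvePoint (by omega)] at hlX
  obtain ⟨p, rfl⟩ := hlX
  rw [curvePoint_mem_ranestadSchreyerLocus_iff hd] at hl
  rw [curvePoint_mem_forbiddenLocus_iff (by omega)]
  intro A hA hA' hp
  have h2 := xRank_le_of_isApolar (A := {p}) (by omega)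
    (isApolar_rootForm_singleton hl hA' hp (by omega))
  rw [Finset.card_singleton] at h2
  omega

theorem forbiddenLocus_subset_ranestadSchreyerLocus (hd : 2 ≤ d)
    (hr : xRank (rationalNormalCurve d) f = d) :
    forbiddenLocus (rationalNormalCurve d) f ⊆
      ranestadSchreyerLocus (rationalNormalCurve d) f 2 := by
  intro l hl
  have hlX := hl.1
  rw [← range_curvePoint (by omega)] at hlX
  obtain ⟨q, rfl⟩ := hlX
  obtain ⟨p, hp⟩ := exists_isApolar_squareForm hd (exists_apolarFunctional_ne_zero f.rep_nonzero)
    fun A hA => hr ▸ xRank_le_of_isApolar (by omega) hA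
  obtain ⟨y, a', b', hy, hΔ, hf⟩ := exists_tangent_of_notMem hd hp fun h => by
    have h2 := xRank_le_of_isApolar (A := {p}) (by omega) h
    rw [Finset.card_singleton] at h2
    omega
  by_contra hRS
  rw [mem_forbiddenLocus_iff fun _ => mem_rationalNormalCurve_of_forall_vanishesAt (by omega)] at hl
  have hpq : p ≠ q := by
    rintro rfl
    exact hRS ((curvePoint_mem_ranestadSchreyerLocus_iff hd).mpr hp)
  set a := (lineCoord p).1 with ha
  set b := (lineCoord p).2 with hb
  obtain ⟨u, v, hu1, hu2⟩ : ∃ u v, (lineCoord q).1 = u * a + v * a' ∧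
      (lineCoord q).2 = u * b + v * b' := by
    refine ⟨((lineCoord q).1 * b' - a' * (lineCoord q).2) / (a * b' - a' * b),
      (a * (lineCoord q).2 - (lineCoord q).1 * b) / (a * b' - a' * b), ?_, ?_⟩
    · rw [div_mul_eq_mul_div, div_mul_eq_mul_div, ← add_div, eq_div_iff hΔ]; ring
    · rw [div_mul_eq_mul_div, div_mul_eq_mul_div, ← add_div, eq_div_iff hΔ]; ring
  have hq : ∀ h, curvePoint d q =
      Projectivization.mk ℂ (veronese d (u * a + v * a') (u * b + v * b')) h := by
    intro h
    rw [curvePoint]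
    congr 1
    rw [hu1, hu2]
  have hne : veronese d (u * a + v * a') (u * b + v * b') ≠ 0 := by
    rw [← hu1, ← hu2]
    exact veronese_lineCoord_ne_zero d q
  -- `v = 0` would make `q` the tangency point `p`.
  have hv : v ≠ 0 := by
    rintro rfl
    apply hpq
    apply curvePoint_injective (d := d) (by omega)
    rw [hq hne, eq_comm]
    refine mk_eq_mk_of_smul _ _ (c := u ^ d) ?_
    rw [← veronese_mul, zero_mul, zero_mul, add_zero, add_zero]
  by_cases huv : d = 2 → u ≠ 0
  · obtain ⟨B, hBX, hB, hfB, hlB⟩ := exists_finset_of_tangent hd hΔ hf hv huv hne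
    refine hl.2 B hBX (le_antisymm (hB.trans hr.ge) (Nat.sInf_le ⟨B, hBX, rfl, hfB⟩)) hfB ?_
    rw [hq hne]
    exact hlB
  -- The exceptional case `d = 2` with `q` the point `M`: `f = L M` up to scalar is also on the
  -- tangent line at `M`, so `q` is in the Ranestad–Schreyer locus after all.
  · push Not at huv
    obtain ⟨rfl, rfl⟩ := huv
    have hΔ' : (0 * a + v * a') * b - a * (0 * b + v * b') ≠ 0 := by
      intro h
      exact mul_ne_zero hv hΔ (by linear_combination -h)
    refine hRS ?_
    rw [hq hne, mem_ranestadSchreyerLocus_iff hΔ' (by omega)]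
    refine ⟨0, y / v, ?_⟩
    rw [zero_smul, zero_add, hf, veroneseCoeff_one_swap]
    ext i
    simp only [Pi.smul_apply, smul_eq_mul, veroneseCoeff_one]
    fin_cases i <;> simp <;> field_simp

theorem ranestadSchreyerLocus_eq_empty (hd : 2 ≤ d) (hr : xRank (rationalNormalCurve d) f ≠ d)
    (hf : f ∉ rationalNormalCurve d) :
    ranestadSchreyerLocus (rationalNormalCurve d) f 2 = ∅ := by
  classical
  rw [Set.eq_empty_iff_forall_notMem]
  intro l hl
  have hlX := hl.1
  rw [← range_curvePoint (by omega)] at hlX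
  obtain ⟨p, rfl⟩ := hlX
  rw [curvePoint_mem_ranestadSchreyerLocus_iff hd] at hl
  have hnot : ¬ IsApolar (apolarFunctional d f.rep) d 1 (rootForm {p}) := by
    intro h
    apply hf
    rw [eq_curvePoint_of_isApolar (by omega) h, ← range_curvePoint (by omega)]
    exact Set.mem_range_self p
  obtain ⟨A, hA, hA'⟩ := exists_isApolar_card_eq_xRank (by omega) f
  rcases lt_or_gt_of_ne hr with hlt | hgt
  -- Rank below `d` leaves room to add `p` to a minimal set without exceeding `d` points.
  · refine hnot (isApolar_rootForm_singleton hl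
      (isApolar_rootForm_mono (Finset.subset_insert p A) hA')
      (Finset.mem_insert_self p A) ?_)
    have := Finset.card_insert_le p A
    omega
  -- A rank above `d` is impossible for a point of a tangent line. The prescribed point `L + M` is
  -- an arbitrary choice with both coordinates nonzero.
  · obtain ⟨y, a', b', hy, hΔ, h⟩ := exists_tangent_of_notMem hd hl hnot
    have hne : veronese d (1 * (lineCoord p).1 + 1 * a') (1 * (lineCoord p).2 + 1 * b') ≠ 0 := by
      refine veronese_ne_zero ?_
      by_contra! h0
      apply hΔ
      linear_combination b' * h0.1 - a' * h0.2
    obtain ⟨B, hBX, hB, hfB, -⟩ := exists_finset_of_tangent hd hΔ h one_ne_zero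
      (fun _ => one_ne_zero) hne
    have : xRank (rationalNormalCurve d) f ≤ B.card := Nat.sInf_le ⟨B, hBX, rfl, hfB⟩
    omega

end Main

theorem mainTheorem9 (d : ℕ) (hd : 2 ≤ d) (f : MvPolynomial (Fin 2) ℂ)
    (hf : f.IsHomogeneous d) (hf0 : f ≠ 0) :
    (xRank (rationalNormalCurve d) (formPoint d f hf hf0) = d →
      forbiddenLocus (rationalNormalCurve d) (formPoint d f hf hf0) =
        ranestadSchreyerLocus (rationalNormalCurve d) (formPoint d f hf hf0) 2) ∧
    (xRank (rationalNormalCurve d) (formPoint d f hf hf0) ≠ d →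
      (formPoint d f hf hf0 ∉ rationalNormalCurve d →
        ranestadSchreyerLocus (rationalNormalCurve d) (formPoint d f hf hf0) 2 = ∅) ∧
      (forbiddenLocus (rationalNormalCurve d) (formPoint d f hf hf0)).Nonempty) :=
  ⟨fun hr => (forbiddenLocus_subset_ranestadSchreyerLocus hd hr).antisymm
    (ranestadSchreyerLocus_subset_forbiddenLocus hd hr),
  fun hr => ⟨ranestadSchreyerLocus_eq_empty hd hr, forbiddenLocus_nonempty (by omega) _⟩⟩

end
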